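/- Let $k$ be an algebraically closed field of characteristic $0$, $V$ a finite-dimensional $k$-vector space with dual $V^\vee$, and $K\subseteq\bigwedge^2V$ a linear subspace. Let $S=\operatorname{Sym}(V)$, let $K^\perp\subseteq\bigwedge^2V^\vee$ be the space of functionals vanishing on $K$, and let $W(V,K)$ be the Koszul module, i.e. the middle homology of the complex of $S$-modules $$K\otimes S\xrightarrow{\ \delta_2\ }V\otimes S\xrightarrow{\ \delta_1\ }S,\qquad \delta_2(v_1\wedge v_2\otimes f)=v_2\otimes v_1f-v_1\otimes v_2f,\quad \delta_1(v\otimes f)=vf .$$ Let $I(V,K)=\operatorname{Ann}_S W(V,K)$, a homogeneous ideal, and let $\mathbf R(V,K)=\operatorname{Proj}\bigl(S/I(V,K)\bigr)$ be the projective resonance scheme. The resonance variety is $$\mathcal R(V,K)=\{a\in V^\vee:\ \exists\, b\in V^\vee,\ a\wedge b\in K^\perp\setminus\{0\}\}\cup\{0\}\subseteq V^\vee ,$$ with the Zariski topology. A linear subspace $\overline V^\vee\subseteq V^\vee$ is called isotropic if $\bigwedge^2\overline V^\vee\subseteq K^\perp$, separable if $K^\perp\cap\langle\overline V^\vee\rangle_E\subseteq\bigwedge^2\overline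 V^\vee$, where $\langle\overline V^\vee\rangle_E$ is the ideal of the exterior algebra $E=\bigwedge V^\vee$ generated by $\overline V^\vee$, and strongly isotropic if it is both. The resonance $\mathcal R(V,K)$ is called isotropic (respectively strongly isotropic) if each of its irreducible components is an isotropic (respectively strongly isotropic) linear subspace of $V^\vee$. (1) Suppose that a linear subspace $\overline V^\vee\subseteq V^\vee$ is an irreducible component of $\mathcal R(V,K)$ and is isotropic. If $\overline V^\vee\neq 0$, then the set of points of $\mathbf R(V,K)$ lying on the linear subspace $\mathbf P(\overline V^\vee)$ of $\mathbf P(V^\vee)=\operatorname{Proj}(S)$ is an irreducible component of $\mathbf R(V,K)$. Let $P$ be this component with its scheme structure inherited from $\mathbf R(V,K)$, i.e. the scheme-theoretic closure in $\mathbf R(V,K)$ of the open subscheme of points that lie on no other irreducible component (if $\overline V^\vee=0$, then $\mathbf R(V,K)$ and $P$ are empty). The following are equivalent: (a) $P$ is reduced; (b) $P$ is generically reduced, i.e. some dense open subscheme of $P$ is reduced; (c) $\overline V^\vee$ is strongly isotropic. (2) Suppose that $\mathcal R(V,K)$ is isotropic. Then $\mathcal R(V,K)$ is strongly isotropic if and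 only if $\mathbf R(V,K)$ is reduced. -/

import Mathlib

open scoped TensorProduct DirectSum
open Module AlgebraicGeometry

noncomputable section

namespace Resonance

/-! ## The symmetric algebra and its standard grading -/

section Grading

variable (k V : Type*) [Field k] [AddCommGroup V] [Module k V]

/-- The symmetric algebra `S = Sym V`: Mathlib's `SymmetricAlgebra`, with its commutative ring
structure as the only one that instance search has to find. -/
def SymmAlg : Type _ := SymmetricAlgebra k V

instance : CommRing (SymmAlg k V) := inferInstanceAs (CommRing (SymmetricAlgebra k V))

instance : Algebra k (SymmAlg k V) := inferInstanceAs (Algebra k (SymmetricAlgebra k V))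

/-- The inclusion `V → Sym V`. -/
def symι : V →ₗ[k] SymmAlg k V := SymmetricAlgebra.ι k V

variable {k V} in
/-- The algebra map `Sym V → A` induced by a linear map `V → A`. -/
def symLift {A : Type*} [CommSemiring A] [Algebra k A] (f : V →ₗ[k] A) : SymmAlg k V →ₐ[k] A :=
  SymmetricAlgebra.lift f

variable {k V} in
theorem symLift_ι {A : Type*} [CommSemiring A] [Algebra k A] (f : V →ₗ[k] A) (v : V) :
    symLift f (symι k V v) = f v :=
  SymmetricAlgebra.lift_ι_apply f v

theorem symAlgHom_ext {A : Type*} [CommSemiring A] [Algebra k A] {F G : SymmAlg k V →ₐ[k] A}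
    (h : ∀ v, F (symι k V v) = G (symι k V v)) : F = G :=
  SymmetricAlgebra.algHom_ext (F := F) (G := G) (LinearMap.ext h)

/-- The degree `i` piece `Sym^i V` of the symmetric algebra `S = Sym V`, spanned by the products
of `i` elements of `V`. -/
def symPow (i : ℕ) : Submodule k (SymmAlg k V) :=
  LinearMap.range (symι k V) ^ i

instance : SetLike.GradedMonoid (symPow k V) :=
  Submodule.nat_power_gradedMonoid (LinearMap.range (symι k V))

theorem ι_mem_symPow (v : V) : symι k V v ∈ symPow k V 1 := by
  rw [symPow, pow_one]
  exact LinearMap.mem_range_self _ v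

/-- Auxiliary: `V → ⨁ Sym^i V`, in degree one. -/
def gradedι : V →ₗ[k] ⨁ i : ℕ, symPow k V i :=
  DirectSum.lof k ℕ (fun i => symPow k V i) 1 ∘ₗ
    (symι k V).codRestrict _ (ι_mem_symPow k V)

theorem gradedι_apply (v : V) : gradedι k V v =
    DirectSum.of (fun i => symPow k V i) 1 ⟨symι k V v, ι_mem_symPow k V v⟩ :=
  rfl

/-- Auxiliary: the decomposition map `Sym V → ⨁ Sym^i V`. -/
def gradedLift : SymmAlg k V →ₐ[k] ⨁ i : ℕ, symPow k V i :=
  symLift (gradedι k V)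

theorem gradedLift_eq (i : ℕ) (x : symPow k V i) :
    gradedLift k V x = DirectSum.of (fun i => symPow k V i) i x := by
  obtain ⟨x, hx⟩ := x
  dsimp only
  induction hx using Submodule.pow_induction_on_left' with
  | algebraMap => simp_rw [AlgHom.commutes, DirectSum.algebraMap_apply]; rfl
  | add _ _ _ _ _ ihx ihy => simp_rw [map_add, ihx, ihy, ← map_add]; rfl
  | mem_mul _ hm _ _ _ ih =>
      obtain ⟨_, rfl⟩ := hm
      simp_rw [map_mul, ih, gradedLift, symLift_ι, gradedι_apply k V,
        DirectSum.of_mul_of]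
      exact DirectSum.of_eq_of_gradedMonoid_eq (Sigma.subtype_ext (add_comm _ _) rfl)

instance symGraded : GradedAlgebra (symPow k V) :=
  GradedAlgebra.ofAlgHom _ (gradedLift k V)
    (by
      refine symAlgHom_ext k V fun v => ?_
      rw [AlgHom.comp_apply, AlgHom.id_apply, gradedLift, symLift_ι, gradedι_apply k V,
        DirectSum.coeAlgHom_of])
    (gradedLift_eq k V)

end Grading

/-! ## The quotient of a graded algebra by a homogeneous ideal -/

section Quotient

variable {k A : Type*} [Field k] [CommRing A] [Algebra k A]

/-- The degree `i` piece of `A ⧸ I`: the image of the degree `i` piece of `A`. -/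
def quotGrading (𝒜 : ℕ → Submodule k A) (I : Ideal A) (i : ℕ) : Submodule k (A ⧸ I) :=
  (𝒜 i).map (Ideal.Quotient.mkₐ k I).toLinearMap

variable (𝒜 : ℕ → Submodule k A) [GradedAlgebra 𝒜] (I : Ideal A)

instance : SetLike.GradedMonoid (quotGrading 𝒜 I) where
  one_mem := ⟨1, SetLike.GradedOne.one_mem, by simp⟩
  mul_mem := by
    rintro i j _ _ ⟨a, ha, rfl⟩ ⟨b, hb, rfl⟩
    exact ⟨a * b, SetLike.GradedMul.mul_mem ha hb, by simp⟩

/-- Auxiliary: `𝒜 i → (A ⧸ I) i`. -/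
def quotPiece (i : ℕ) : 𝒜 i →ₗ[k] quotGrading 𝒜 I i :=
  ((Ideal.Quotient.mkₐ k I).toLinearMap.domRestrict (𝒜 i)).codRestrict _
    (fun x => ⟨x, x.2, rfl⟩)

/-- Auxiliary: `A → ⨁ (A ⧸ I) i`. -/
def quotDecomposeAux : A →ₗ[k] ⨁ i, quotGrading 𝒜 I i :=
  DirectSum.lmap (quotPiece 𝒜 I) ∘ₗ (DirectSum.decomposeLinearEquiv 𝒜).toLinearMap

theorem quotDecomposeAux_apply (a : A) (i : ℕ) :
    ((quotDecomposeAux 𝒜 I a) i : A ⧸ I) = Ideal.Quotient.mk I (DirectSum.decompose 𝒜 a i : A) := by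
  rw [quotDecomposeAux, LinearMap.comp_apply, DirectSum.lmap_apply]
  rfl

variable {I} in
theorem quotDecomposeAux_eq_zero (hI : I.IsHomogeneous 𝒜) (a : A) (ha : a ∈ I) :
    quotDecomposeAux 𝒜 I a = 0 := by
  refine DFinsupp.ext fun i => Subtype.ext ?_
  rw [quotDecomposeAux_apply]
  exact Ideal.Quotient.eq_zero_iff_mem.mpr (hI i ha)

theorem quotDecomposeAux_of_mem (i : ℕ) (a : A) (ha : a ∈ 𝒜 i) :
    quotDecomposeAux 𝒜 I a =
      DirectSum.of (fun i => quotGrading 𝒜 I i) i ⟨Ideal.Quotient.mk I a, a, ha, rfl⟩ := by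
  simp only [quotDecomposeAux, LinearMap.comp_apply, LinearEquiv.coe_coe,
    DirectSum.decomposeLinearEquiv_apply, DirectSum.decompose_of_mem 𝒜 ha]
  exact DirectSum.lmap_lof (quotPiece 𝒜 I) i ⟨a, ha⟩

variable {I} in
/-- Auxiliary: the decomposition map `A ⧸ I → ⨁ (A ⧸ I) i`. -/
def quotDecompose (hI : I.IsHomogeneous 𝒜) : (A ⧸ I) →ₗ[k] ⨁ i, quotGrading 𝒜 I i where
  toFun x := Quotient.liftOn' x (quotDecomposeAux 𝒜 I) fun a b h => by
    have h0 := quotDecomposeAux_eq_zero 𝒜 hI _ ((Submodule.quotientRel_def I).mp h)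
    have h1 : quotDecomposeAux 𝒜 I a = quotDecomposeAux 𝒜 I (a - b) + quotDecomposeAux 𝒜 I b := by
      rw [← map_add, sub_add_cancel]
    rw [h1, h0, zero_add]
  map_add' := by
    rintro ⟨a⟩ ⟨b⟩
    exact map_add (quotDecomposeAux 𝒜 I) a b
  map_smul' := by
    rintro c ⟨a⟩
    exact map_smul (quotDecomposeAux 𝒜 I) c a

variable {I} in
/-- The grading of `A ⧸ I` induced by a grading of `A`, for `I` homogeneous. -/
@[reducible] def quotGraded (hI : I.IsHomogeneous 𝒜) : GradedAlgebra (quotGrading 𝒜 I) where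
  toDecomposition := DirectSum.Decomposition.ofLinearMap _ (quotDecompose 𝒜 hI)
    (by
      refine LinearMap.ext fun x => ?_
      obtain ⟨a, rfl⟩ := Ideal.Quotient.mk_surjective x
      change DirectSum.coeLinearMap _ (quotDecomposeAux 𝒜 I a) = Ideal.Quotient.mk I a
      induction a using DirectSum.Decomposition.inductionOn 𝒜 with
      | zero => simp
      | homogeneous a =>
        rw [quotDecomposeAux_of_mem 𝒜 I _ _ a.2, DirectSum.coeLinearMap_of]
      | add a b ha hb => rw [map_add, map_add, ha, hb, map_add])
    (by
      refine DirectSum.linearMap_ext _ fun i => LinearMap.ext ?_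
      rintro ⟨_, a, ha, rfl⟩
      simp only [LinearMap.comp_apply, DirectSum.lof_eq_of, DirectSum.coeLinearMap_of]
      exact quotDecomposeAux_of_mem 𝒜 I i a ha)

end Quotient

/-! ## The Koszul module -/

section Koszul

variable {k V : Type*} [Field k] [AddCommGroup V] [Module k V]

variable (k V) in
/-- `δ₁ : S ⊗ V → S`, `f ⊗ v ↦ f v`. -/
def δ₁ : SymmAlg k V ⊗[k] V →ₗ[SymmAlg k V] SymmAlg k V :=
  LinearMap.liftBaseChange (SymmAlg k V) (symι k V)

variable (k V) in
/-- The bilinear map `(v₁, v₂) ↦ v₁ ⊗ v₂ ∈ S ⊗ V`, the first factor being seen in `S`. -/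
def koszulBilin : V →ₗ[k] V →ₗ[k] SymmAlg k V ⊗[k] V :=
  (TensorProduct.mk k (SymmAlg k V) V) ∘ₗ symι k V

variable (k V) in
/-- The alternating map `(v₁, v₂) ↦ v₁ ⊗ v₂ - v₂ ⊗ v₁ ∈ S ⊗ V`. -/
def koszulAlt : V [⋀^Fin 2]→ₗ[k] SymmAlg k V ⊗[k] V where
  toFun v := koszulBilin k V (v 0) (v 1) - koszulBilin k V (v 1) (v 0)
  map_update_add' := by
    intro _ v i x y
    fin_cases i <;> simp <;> abel
  map_update_smul' := by
    intro _ v i c x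
    fin_cases i <;> simp [smul_sub]
  map_eq_zero_of_eq' := by
    intro v i j hv hij
    fin_cases i <;> fin_cases j <;> simp_all

variable (k V) in
/-- The Koszul differential `δ₂ : S ⊗ ⋀² V → S ⊗ V`,
`f ⊗ (v₁ ∧ v₂) ↦ f v₁ ⊗ v₂ - f v₂ ⊗ v₁`. -/
def δ₂ : SymmAlg k V ⊗[k] (⋀[k]^2 V) →ₗ[SymmAlg k V]
    SymmAlg k V ⊗[k] V :=
  LinearMap.liftBaseChange (SymmAlg k V)
    (exteriorPower.alternatingMapLinearEquiv (koszulAlt k V))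

theorem δ₂_tmul (f : SymmAlg k V) (v : Fin 2 → V) :
    δ₂ k V (f ⊗ₜ exteriorPower.ιMulti k 2 v) =
      (f * symι k V (v 0)) ⊗ₜ v 1 - (f * symι k V (v 1)) ⊗ₜ v 0 := by
  rw [δ₂, LinearMap.liftBaseChange_tmul, exteriorPower.alternatingMapLinearEquiv_apply_ιMulti]
  simp [koszulAlt, koszulBilin, smul_sub, TensorProduct.smul_tmul']

/-- The restriction of the Koszul differential to `S ⊗ K`. -/
def δ₂K (K : Submodule k (⋀[k]^2 V)) :
    SymmAlg k V ⊗[k] K →ₗ[SymmAlg k V] SymmAlg k V ⊗[k] V :=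
  δ₂ k V ∘ₗ LinearMap.baseChange (SymmAlg k V) K.subtype

instance : AddCommGroup (LinearMap.ker (δ₁ k V)) := Submodule.addCommGroup _

/-- The Koszul module `W(V, K)`: the middle homology of `S ⊗ K → S ⊗ V → S`. -/
abbrev KoszulModule (K : Submodule k (⋀[k]^2 V)) : Type _ :=
  LinearMap.ker (δ₁ k V) ⧸ (LinearMap.range (δ₂K K)).submoduleOf (LinearMap.ker (δ₁ k V))

/-- The annihilator `I(V, K)` of the Koszul module. -/
def resIdeal (K : Submodule k (⋀[k]^2 V)) : Ideal (SymmAlg k V) :=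
  Module.annihilator (SymmAlg k V) (KoszulModule K)

theorem mem_resIdeal (K : Submodule k (⋀[k]^2 V)) (s : SymmAlg k V) :
    s ∈ resIdeal K ↔ ∀ x, δ₁ k V x = 0 → s • x ∈ LinearMap.range (δ₂K K) := by
  rw [resIdeal, Module.mem_annihilator]
  constructor
  · intro h x hx
    have := h (Submodule.Quotient.mk ⟨x, hx⟩)
    rw [← Submodule.Quotient.mk_smul, Submodule.Quotient.mk_eq_zero] at this
    exact this
  · rintro h ⟨x, hx⟩
    exact (Submodule.Quotient.mk_eq_zero _).mpr (h x hx)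

/-! ### The annihilator is homogeneous -/

/-- Auxiliary: the projection of `S ⊗ X` onto its degree `i` piece. -/
def degProj (X : Type*) [AddCommGroup X] [Module k X] (i : ℕ) :
    SymmAlg k V ⊗[k] X →ₗ[k] SymmAlg k V ⊗[k] X :=
  LinearMap.rTensor X (GradedAlgebra.proj (symPow k V) i)

theorem degProj_tmul {X : Type*} [AddCommGroup X] [Module k X] (i : ℕ)
    (f : SymmAlg k V) (x : X) :
    degProj X i (f ⊗ₜ[k] x) = (DirectSum.decompose (symPow k V) f i : SymmAlg k V) ⊗ₜ x :=
  rfl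

theorem degProj_smul {X : Type*} [AddCommGroup X] [Module k X] (i j : ℕ)
    (s : SymmAlg k V) (x : SymmAlg k V ⊗[k] X) :
    degProj X (i + j) (s • degProj X j x) =
      (DirectSum.decompose (symPow k V) s i : SymmAlg k V) • degProj X j x := by
  induction x with
  | zero => simp
  | add x y hx hy => simp only [map_add, smul_add, hx, hy]
  | tmul f x =>
    rw [degProj_tmul, TensorProduct.smul_tmul', TensorProduct.smul_tmul', degProj_tmul, smul_eq_mul,
      DirectSum.coe_decompose_mul_add_of_right_mem (symPow k V) (SetLike.coe_mem _), smul_eq_mul]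

theorem exists_sum_degProj {X : Type*} [AddCommGroup X] [Module k X]
    (x : SymmAlg k V ⊗[k] X) :
    ∃ N, ∀ n ≥ N, ∑ j ∈ Finset.range n, degProj X j x = x := by
  induction x with
  | zero => exact ⟨0, by simp⟩
  | add x y hx hy =>
    obtain ⟨N, hN⟩ := hx
    obtain ⟨M, hM⟩ := hy
    refine ⟨max N M, fun n hn => ?_⟩
    simp only [map_add, Finset.sum_add_distrib]
    rw [hN n (le_trans (le_max_left _ _) hn), hM n (le_trans (le_max_right _ _) hn)]
  | tmul f x =>
    classical
    refine ⟨(DirectSum.decompose (symPow k V) f).support.sup id + 1, fun n hn => ?_⟩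
    simp only [degProj_tmul]
    rw [← TensorProduct.sum_tmul]
    congr 1
    conv_rhs => rw [← DirectSum.sum_support_decompose (symPow k V) f]
    symm
    refine Finset.sum_subset (fun i hi => ?_) (fun i _ hi => ?_)
    · have : i ≤ (DirectSum.decompose (symPow k V) f).support.sup id := Finset.le_sup (f := id) hi
      exact Finset.mem_range.mpr (by omega)
    · simpa using hi

theorem decompose_mul_ι (f : SymmAlg k V) (v : V) (j : ℕ) :
    (DirectSum.decompose (symPow k V) (f * symι k V v) (j + 1) :
      SymmAlg k V) =
      (DirectSum.decompose (symPow k V) f j : SymmAlg k V) * symι k V v :=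
  DirectSum.coe_decompose_mul_add_of_right_mem (symPow k V) (ι_mem_symPow k V v)

theorem decompose_mul_ι_zero (f : SymmAlg k V) (v : V) :
    (DirectSum.decompose (symPow k V) (f * symι k V v) 0 :
      SymmAlg k V) = 0 :=
  DirectSum.coe_decompose_mul_of_right_mem_of_not_le (symPow k V) (ι_mem_symPow k V v) (by omega)

theorem δ₁_degProj (x : SymmAlg k V ⊗[k] V) (j : ℕ) :
    δ₁ k V (degProj V j x) =
      (DirectSum.decompose (symPow k V) (δ₁ k V x) (j + 1) : SymmAlg k V) := by
  induction x with
  | zero => simp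
  | add x y hx hy => simp only [map_add, hx, hy, DirectSum.decompose_add, DirectSum.add_apply,
      Submodule.coe_add]
  | tmul f v =>
    rw [degProj_tmul, δ₁, LinearMap.liftBaseChange_tmul, LinearMap.liftBaseChange_tmul, smul_eq_mul,
      smul_eq_mul, decompose_mul_ι]

theorem δ₂_degProj (x : SymmAlg k V ⊗[k] (⋀[k]^2 V)) (j : ℕ) :
    degProj V (j + 1) (δ₂ k V x) = δ₂ k V (degProj _ j x) := by
  induction x with
  | zero => simp
  | add x y hx hy => simp only [map_add, hx, hy]
  | tmul f w =>
    have hw : w ∈ Submodule.span k (Set.range (exteriorPower.ιMulti k 2 (M := V))) := by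
      rw [exteriorPower.ιMulti_span]; trivial
    induction hw using Submodule.span_induction with
    | mem w h =>
      obtain ⟨v, rfl⟩ := h
      rw [degProj_tmul, δ₂_tmul, δ₂_tmul, map_sub, degProj_tmul, degProj_tmul, decompose_mul_ι,
        decompose_mul_ι]
    | zero => simp
    | add x y _ _ hx hy => simp only [TensorProduct.tmul_add, map_add, hx, hy]
    | smul c x _ hx =>
      rw [TensorProduct.tmul_smul, LinearMap.map_smul_of_tower, LinearMap.map_smul_of_tower, hx, LinearMap.map_smul_of_tower,
        LinearMap.map_smul_of_tower]

theorem δ₂_degProj_zero (x : SymmAlg k V ⊗[k] (⋀[k]^2 V)) :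
    degProj V 0 (δ₂ k V x) = 0 := by
  induction x with
  | zero => simp
  | add x y hx hy => simp only [map_add, hx, hy, add_zero]
  | tmul f w =>
    have hw : w ∈ Submodule.span k (Set.range (exteriorPower.ιMulti k 2 (M := V))) := by
      rw [exteriorPower.ιMulti_span]; trivial
    induction hw using Submodule.span_induction with
    | mem w h =>
      obtain ⟨v, rfl⟩ := h
      rw [δ₂_tmul, map_sub, degProj_tmul, degProj_tmul, decompose_mul_ι_zero,
        decompose_mul_ι_zero]
      simp
    | zero => simp
    | add x y _ _ hx hy => simp only [TensorProduct.tmul_add, map_add, hx, hy, add_zero]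
    | smul c x _ hx =>
      rw [TensorProduct.tmul_smul, LinearMap.map_smul_of_tower, LinearMap.map_smul_of_tower, hx, smul_zero]

theorem degProj_δ₂K_mem (K : Submodule k (⋀[k]^2 V)) (z : SymmAlg k V ⊗[k] K) (m : ℕ) :
    degProj V m (δ₂K K z) ∈ LinearMap.range (δ₂K K) := by
  cases m with
  | zero =>
    rw [δ₂K, LinearMap.comp_apply, δ₂_degProj_zero]
    exact zero_mem _
  | succ m =>
    refine ⟨degProj K m z, ?_⟩
    rw [δ₂K, LinearMap.comp_apply, LinearMap.comp_apply, δ₂_degProj]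
    congr 1
    induction z with
    | zero => simp
    | add x y hx hy => simp only [map_add, hx, hy]
    | tmul f w => simp [degProj_tmul]

theorem resIdeal_isHomogeneous (K : Submodule k (⋀[k]^2 V)) :
    (resIdeal K).IsHomogeneous (symPow k V) := by
  intro i s hs
  rw [mem_resIdeal] at hs ⊢
  intro x hx
  obtain ⟨N, hN⟩ := exists_sum_degProj x
  rw [← hN N le_rfl, Finset.smul_sum]
  refine Submodule.sum_mem _ fun j _ => ?_
  rw [← degProj_smul]
  obtain ⟨z, hz⟩ := hs (degProj V j x) (by rw [δ₁_degProj, hx]; simp)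
  rw [← hz]
  exact degProj_δ₂K_mem K z _

end Koszul

/-! ## Resonance -/

section Res

variable {k V : Type*} [Field k] [AddCommGroup V] [Module k V]

/-- `K^⊥ ⊆ ⋀² V^∨`: the functionals on `⋀² V` that vanish on `K`. -/
def perp (K : Submodule k (⋀[k]^2 V)) : Submodule k (⋀[k]^2 (Dual k V)) :=
  K.dualAnnihilator.comap (exteriorPower.pairingDual k V 2)

/-- The resonance variety
`R(V, K) = {a ∈ V^∨ | ∃ b ∈ V^∨, a ∧ b ∈ K^⊥ ∖ {0}} ∪ {0}`. -/
def resonance (K : Submodule k (⋀[k]^2 V)) : Set (Dual k V) :=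
  {a | ∃ b : Dual k V, exteriorPower.ιMulti k 2 ![a, b] ∈ perp K ∧
    exteriorPower.ιMulti k 2 ![a, b] ≠ 0} ∪ {0}

variable (k V) in
/-- The Zariski topology of the affine space `V^∨`, whose coordinate ring is `Sym V`: a point `a`
is identified with the kernel of the evaluation `Sym V → k` at `a`. -/
@[reducible] def zariski : TopologicalSpace (Dual k V) :=
  TopologicalSpace.induced
    (fun a => (⟨RingHom.ker (symLift a : SymmAlg k V →ₐ[k] k),
      RingHom.ker_isPrime _⟩ : PrimeSpectrum (SymmAlg k V)))
    inferInstance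

/-- `C` is an irreducible component of the resonance variety, for the Zariski topology. -/
def IsComponent (K : Submodule k (⋀[k]^2 V)) (C : Set (Dual k V)) : Prop :=
  Maximal (fun s => @IsIrreducible _ (zariski k V) s ∧ s ⊆ resonance K) C

/-- `⋀² U` inside `⋀² V^∨`, for a linear subspace `U ⊆ V^∨`. -/
def wedgeSq (U : Submodule k (Dual k V)) : Submodule k (⋀[k]^2 (Dual k V)) :=
  LinearMap.range (exteriorPower.map (R := k) (M := U) (N := Dual k V) 2 U.subtype)

/-- A subspace `U ⊆ V^∨` is isotropic if `⋀² U ⊆ K^⊥`. -/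
def IsIsotropic (K : Submodule k (⋀[k]^2 V)) (U : Submodule k (Dual k V)) : Prop :=
  wedgeSq U ≤ perp K

/-- A subspace `U ⊆ V^∨` is separable if `K^⊥ ∩ ⟨U⟩_E ⊆ ⋀² U`, where `⟨U⟩_E` is the two-sided ideal
generated by `U` in the exterior algebra `E` of `V^∨`. -/
def IsSeparable (K : Submodule k (⋀[k]^2 V)) (U : Submodule k (Dual k V)) : Prop :=
  ∀ w ∈ perp K, (w : ExteriorAlgebra k (Dual k V)) ∈
      TwoSidedIdeal.span (ExteriorAlgebra.ι k '' (U : Set (Dual k V))) →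
    w ∈ wedgeSq U

/-- Strongly isotropic means separable and isotropic. -/
def IsStronglyIsotropic (K : Submodule k (⋀[k]^2 V)) (U : Submodule k (Dual k V)) : Prop :=
  IsSeparable K U ∧ IsIsotropic K U

/-- The resonance is isotropic: every irreducible component of the resonance variety is an
isotropic linear subspace. -/
def IsotropicResonance (K : Submodule k (⋀[k]^2 V)) : Prop :=
  ∀ C, IsComponent K C → ∃ U : Submodule k (Dual k V), (U : Set (Dual k V)) = C ∧ IsIsotropic K U

/-- The resonance is strongly isotropic: every irreducible component of the resonance variety is
a strongly isotropic linear subspace. -/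
def StronglyIsotropicResonance (K : Submodule k (⋀[k]^2 V)) : Prop :=
  ∀ C, IsComponent K C →
    ∃ U : Submodule k (Dual k V), (U : Set (Dual k V)) = C ∧ IsStronglyIsotropic K U

/-! ### The projective resonance scheme -/

/-- The grading of `S ⧸ I(V, K)`. -/
def resGrading (K : Submodule k (⋀[k]^2 V)) (i : ℕ) :
    Submodule k (SymmAlg k V ⧸ resIdeal K) :=
  quotGrading (symPow k V) (resIdeal K) i

instance (K : Submodule k (⋀[k]^2 V)) : GradedAlgebra (resGrading K) :=
  quotGraded (symPow k V) (resIdeal_isHomogeneous K)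

/-- The projective resonance scheme `Proj (S ⧸ I(V, K))`. -/
def projResonance (K : Submodule k (⋀[k]^2 V)) : Scheme := Proj (resGrading K)

instance (K : Submodule k (⋀[k]^2 V)) [FiniteDimensional k V] :
    AlgebraicGeometry.IsNoetherian (projResonance K) := by
  have h1 : Algebra.FiniteType k (SymmAlg k V) :=
    Algebra.FiniteType.equiv (inferInstanceAs (Algebra.FiniteType k (MvPolynomial _ k)))
      (SymmetricAlgebra.equivMvPolynomial (Module.finBasis k V)).symm
  have h2 : Algebra.FiniteType k (SymmAlg k V ⧸ resIdeal K) :=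
    Algebra.FiniteType.of_surjective (Ideal.Quotient.mkₐ k (resIdeal K))
      (Ideal.Quotient.mkₐ_surjective k _)
  have : IsScalarTower k (resGrading K 0) (SymmAlg k V ⧸ resIdeal K) :=
    ⟨fun c x y => smul_mul_assoc c (x : SymmAlg k V ⧸ resIdeal K) y⟩
  have h3 : Algebra.FiniteType (resGrading K 0) (SymmAlg k V ⧸ resIdeal K) :=
    Algebra.FiniteType.of_restrictScalars_finiteType k _ _
  have h4 : IsNoetherianRing (resGrading K 0) := by
    refine isNoetherianRing_of_surjective k _ (algebraMap k (resGrading K 0)) ?_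
    rintro ⟨_, a, ha, rfl⟩
    have ha' : a ∈ (1 : Submodule k (SymmAlg k V)) := by simpa [symPow] using ha
    obtain ⟨c, rfl⟩ := Submodule.mem_one.mp ha'
    exact ⟨c, rfl⟩
  have h5 : IsLocallyNoetherian (Proj (resGrading K)) :=
    LocallyOfFiniteType.isLocallyNoetherian (Proj.toSpecZero (resGrading K))
  have h6 : CompactSpace (Proj (resGrading K)) :=
    QuasiCompact.compactSpace_of_compactSpace (Proj.toSpecZero (resGrading K))
  exact { __ := h5, __ := h6 }

/-- The set of points of the projective resonance scheme that lie on the linear subspace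
`P(U) ⊆ P(V^∨)`: the linear forms `v ∈ V` that vanish on `U` vanish at these points. -/
def linearLocus (K : Submodule k (⋀[k]^2 V)) (U : Submodule k (Dual k V)) :
    Set (projResonance K) :=
  ProjectiveSpectrum.zeroLocus (resGrading K)
    ((fun v => Ideal.Quotient.mk (resIdeal K) (symι k V v)) ''
      {v : V | ∀ a ∈ U, a v = 0})

/-- The closed subscheme of the projective resonance scheme that corresponds to a component `U`
of the resonance variety: the scheme-theoretic closure of the open subscheme of all points that lie
on no irreducible component other than `P(U)`. By `projComponent_eq` this is Mathlib's scheme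
structure on the irreducible component `P(U)`. If `U = 0`, so that the projective resonance scheme
is empty, it is empty. -/
def projComponent [FiniteDimensional k V] (K : Submodule k (⋀[k]^2 V))
    (U : Submodule k (Dual k V)) : Scheme :=
  ((projResonance K).irreducibleComponentOpen (linearLocus K U)).ι.image

theorem projComponent_eq [FiniteDimensional k V] (K : Submodule k (⋀[k]^2 V))
    (U : Submodule k (Dual k V)) (h : linearLocus K U ∈ irreducibleComponents (projResonance K)) :
    (projResonance K).irreducibleComponent (linearLocus K U) h = projComponent K U := by
  rw [Scheme.irreducibleComponent, Scheme.irreducibleComponentIdeal_def]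
  rfl

end Res

/-- A scheme is generically reduced if it has a dense open subscheme which is reduced. -/
def IsGenericallyReduced (X : Scheme) : Prop :=
  ∃ O : X.Opens, Dense (O : Set X) ∧ AlgebraicGeometry.IsReduced O.toScheme

end Resonance

end

noncomputable section

namespace Resonance

/-! ## The exterior square -/

section Wedge

/-! Let `I = resIdeal K`, and for `U ⊆ V^∨` let `L = linearIdeal U` be the prime of polynomials
vanishing on `U`, generated by `U^⊥ ⊆ V`. The theorem is a local comparison of `I` with `L`.

A nonzero component `U` has dimension at least two (`IsComponent.not_le_span_singleton`), and if it
is isotropic then `I ≤ L` (`resIdeal_le_linearIdeal`). Away from `0` the zeros of `I` are resonant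
(`mem_resonance_of_resIdeal_le`), so by the Nullstellensatz the maximality of `U` makes `L` a
minimal prime over `I`. Hence `P(U)` is a component of the scheme.

If `U` is separable, then dually `V ∧ U^⊥ ⊆ K + ⋀² U^⊥`. Nakayama's lemma at a non-irrelevant prime
`q ≥ L` turns this into an `f ∉ q` with `f L ⊆ I` (`IsSeparable.exists_mul_mem`). So `I` and `L`
agree at every point of `P(U)`, and the stalks there are reduced.

Conversely, a dense open subscheme contains the generic point, so generic reducedness gives, for
each `x ∈ U^⊥`, some `f ∉ L` with `f x ∈ I`. An element `w = ∑ a_i ∧ g_i` of `K^⊥ ∩ ⟨U⟩` is a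
first-order deformation: the map `s ⊗ v ↦ ∑ a_i(v) (∂_{g_i} s)|_U` kills the image of `S ⊗ K`.
Evaluating it on `f x` times a Koszul cycle forces `g_i(x) = 0`, hence `w ∈ ⋀² U`
(`isSeparable_of_exists_mul_mem`).

If `U = 0` is a component, the scheme is empty and `0` is strongly isotropic. For the global
statement, the zeros of the prime of any point form an irreducible subset of the resonance, so every
point lies on `P(U)` for some component `U`. -/

theorem update_zero_pair {X : Type*} (x y z : X) : Function.update ![x, y] 0 z = ![z, y] := by
  ext i
  fin_cases i <;> rfl

theorem update_one_pair {X : Type*} (x y z : X) : Function.update ![x, y] 1 z = ![x, z] := by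
  ext i
  fin_cases i <;> rfl

variable {k V : Type*} [Field k] [AddCommGroup V] [Module k V]

variable (k V) in
/-- The wedge product `V × V → ⋀² V` as a bilinear map. -/
def wedge : V →ₗ[k] V →ₗ[k] ⋀[k]^2 V :=
  LinearMap.mk₂ k (fun v w => exteriorPower.ιMulti k 2 ![v, w])
    (fun x y w => by
      have h := (exteriorPower.ιMulti k 2).map_update_add ![x, w] 0 x y
      simpa only [update_zero_pair, update_one_pair] using h)
    (fun c x w => by
      have h := (exteriorPower.ιMulti k 2).map_update_smul ![x, w] 0 c x
      simpa only [update_zero_pair, update_one_pair] using h)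
    (fun x y z => by
      have h := (exteriorPower.ιMulti k 2).map_update_add ![x, y] 1 y z
      simpa only [update_zero_pair, update_one_pair] using h)
    (fun c x y => by
      have h := (exteriorPower.ιMulti k 2).map_update_smul ![x, y] 1 c y
      simpa only [update_zero_pair, update_one_pair] using h)

theorem wedge_apply (v w : V) : wedge k V v w = exteriorPower.ιMulti k 2 ![v, w] := rfl

theorem wedge_self (v : V) : wedge k V v v = 0 := by
  rw [wedge_apply]
  exact (exteriorPower.ιMulti k 2).map_eq_zero_of_eq ![v, v] (i := 0) (j := 1) rfl (by simp)

theorem wedge_swap (v w : V) : wedge k V v w = -wedge k V w v := by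
  have h := wedge_self (k := k) (v + w)
  simp only [map_add, LinearMap.add_apply, wedge_self, zero_add, add_zero] at h
  exact eq_neg_of_add_eq_zero_right h

theorem span_wedge : Submodule.span k {x | ∃ v w : V, wedge k V v w = x} = ⊤ := by
  rw [← exteriorPower.ιMulti_span k 2]
  congr 1
  ext x
  constructor
  · rintro ⟨v, w, rfl⟩
    exact ⟨_, rfl⟩
  · rintro ⟨v, rfl⟩
    refine ⟨v 0, v 1, ?_⟩
    rw [wedge_apply]
    congr 1
    ext i
    fin_cases i <;> rfl

theorem wedge_hom_ext {X : Type*} [AddCommGroup X] [Module k X] {f g : ⋀[k]^2 V →ₗ[k] X}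
    (h : ∀ v w, f (wedge k V v w) = g (wedge k V v w)) : f = g := by
  refine LinearMap.ext_on (span_wedge (k := k) (V := V)) ?_
  rintro _ ⟨v, w, rfl⟩
  exact h v w

theorem map_wedge {X : Type*} [AddCommGroup X] [Module k X] (f : V →ₗ[k] X) (v w : V) :
    exteriorPower.map 2 f (wedge k V v w) = wedge k X (f v) (f w) := by
  rw [wedge_apply, exteriorPower.map_apply_ιMulti, wedge_apply]
  congr 1
  ext i : 1
  fin_cases i <;> rfl

theorem pairingDual_wedge (a b : Dual k V) (v w : V) :
    exteriorPower.pairingDual k V 2 (wedge k _ a b) (wedge k V v w) = a v * b w - a w * b v := by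
  rw [wedge_apply, wedge_apply, exteriorPower.pairingDual_ιMulti_ιMulti, Matrix.det_fin_two]
  simp [mul_comm]

theorem mem_perp {K : Submodule k (⋀[k]^2 V)} {w : ⋀[k]^2 (Dual k V)} :
    w ∈ perp K ↔ ∀ x ∈ K, exteriorPower.pairingDual k V 2 w x = 0 := by
  rw [perp, Submodule.mem_comap, Submodule.mem_dualAnnihilator]

theorem wedge_mem_wedgeSq {U : Submodule k (Dual k V)} {a b : Dual k V} (ha : a ∈ U)
    (hb : b ∈ U) : wedge k _ a b ∈ wedgeSq U := by
  exact ⟨wedge k U ⟨a, ha⟩ ⟨b, hb⟩, map_wedge _ _ _⟩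

theorem wedgeSq_le {U : Submodule k (Dual k V)} {N : Submodule k (⋀[k]^2 (Dual k V))}
    (h : ∀ a ∈ U, ∀ b ∈ U, wedge k _ a b ∈ N) : wedgeSq U ≤ N := by
  rw [wedgeSq, LinearMap.range_eq_map, ← span_wedge, Submodule.map_span, Submodule.span_le]
  rintro _ ⟨_, ⟨a, b, rfl⟩, rfl⟩
  rw [map_wedge]
  exact h a a.2 b b.2

theorem isIsotropic_iff {K : Submodule k (⋀[k]^2 V)} {U : Submodule k (Dual k V)} :
    IsIsotropic K U ↔ ∀ a ∈ U, ∀ b ∈ U, wedge k _ a b ∈ perp K :=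
  ⟨fun h _ ha _ hb => h (wedge_mem_wedgeSq ha hb), wedgeSq_le⟩

theorem coe_wedge (v w : V) :
    (wedge k V v w : ExteriorAlgebra k V) = ExteriorAlgebra.ι k v * ExteriorAlgebra.ι k w := by
  rw [wedge_apply, exteriorPower.ιMulti_apply_coe, ExteriorAlgebra.ιMulti_apply]
  simp

theorem wedge_mem_span {U : Submodule k (Dual k V)} {a b : Dual k V} (ha : a ∈ U) :
    (wedge k _ a b : ExteriorAlgebra k (Dual k V)) ∈
      TwoSidedIdeal.span (ExteriorAlgebra.ι k '' (U : Set (Dual k V))) := by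
  rw [coe_wedge]
  exact TwoSidedIdeal.mul_mem_right _ _ _ (TwoSidedIdeal.subset_span ⟨a, ha, rfl⟩)

/-- Elements of the ideal generated by `U` vanish on `⋀² U^⊥`. -/
theorem pairingDual_eq_zero_of_mem_span {U : Submodule k (Dual k V)} {w : ⋀[k]^2 (Dual k V)}
    (hw : (w : ExteriorAlgebra k (Dual k V)) ∈
      TwoSidedIdeal.span (ExteriorAlgebra.ι k '' (U : Set (Dual k V)))) {x y : V}
    (hx : x ∈ U.dualCoannihilator) (hy : y ∈ U.dualCoannihilator) :
    exteriorPower.pairingDual k V 2 w (wedge k V x y) = 0 := by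
  set W := U.dualCoannihilator
  set r : Dual k V →ₗ[k] Dual k W := W.subtype.dualMap
  -- Restricting functionals to `U^⊥` is functorial on exterior algebras and kills `U`, hence the
  -- ideal that `U` generates.
  have h1 : TwoSidedIdeal.span (ExteriorAlgebra.ι k '' (U : Set (Dual k V))) ≤
      TwoSidedIdeal.ker (ExteriorAlgebra.map r) := by
    rw [TwoSidedIdeal.span_le]
    rintro _ ⟨a, ha, rfl⟩
    have : r a = 0 := by
      ext z
      exact (Submodule.mem_dualCoannihilator _).mp z.2 a ha
    simp [TwoSidedIdeal.mem_ker, this]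
  have h2 : ExteriorAlgebra.map r (w : ExteriorAlgebra k (Dual k V)) = 0 :=
    (TwoSidedIdeal.mem_ker _).mp (h1 hw)
  have h3 : exteriorPower.map 2 r w = 0 := by
    have h : (⋀[k]^2 (Dual k W)).subtype ∘ₗ exteriorPower.map 2 r =
        (ExteriorAlgebra.map r).toLinearMap ∘ₗ (⋀[k]^2 (Dual k V)).subtype := by
      refine wedge_hom_ext fun a b => ?_
      simp [map_wedge, coe_wedge]
    exact Subtype.ext ((LinearMap.congr_fun h w).trans h2)
  have h4 : (LinearMap.applyₗ (wedge k V x y)) ∘ₗ exteriorPower.pairingDual k V 2 =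
      (LinearMap.applyₗ (wedge k W ⟨x, hx⟩ ⟨y, hy⟩)) ∘ₗ exteriorPower.pairingDual k W 2 ∘ₗ
        exteriorPower.map 2 r := by
    refine wedge_hom_ext fun a b => ?_
    simp only [LinearMap.comp_apply, map_wedge, LinearMap.applyₗ_apply_apply, pairingDual_wedge]
    rfl
  have h5 := LinearMap.congr_fun h4 w
  simpa [h3] using h5

/-- Elements of `⋀² V^∨` are determined by the functionals on `⋀² V` that they define. -/
theorem pairingDual_injective [CharZero k] [FiniteDimensional k V] :
    Function.Injective (exteriorPower.pairingDual k V 2) := by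
  set b := finBasis k V
  -- The sum runs over ordered pairs of indices, so each basis bivector is counted twice. This is
  -- where the factor `2` and characteristic zero enter.
  have h : (2 : k) • LinearMap.id = ∑ i, ∑ j,
      (LinearMap.applyₗ (wedge k V (b i) (b j)) ∘ₗ exteriorPower.pairingDual k V 2).smulRight
        (wedge k _ (b.coord i) (b.coord j)) := by
    refine wedge_hom_ext fun f g => ?_
    have expand : ∀ f : Dual k V, ∑ i, f (b i) • b.coord i = f := fun f => b.sum_dual_apply_smul_coord f
    simp only [LinearMap.smul_apply, LinearMap.id_apply, LinearMap.sum_apply,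
      LinearMap.smulRight_apply, LinearMap.comp_apply, LinearMap.applyₗ_apply_apply,
      pairingDual_wedge, sub_smul, Finset.sum_sub_distrib]
    have e1 : ∀ f g : Dual k V, ∑ i, ∑ j, (f (b i) * g (b j)) •
        wedge k _ (b.coord i) (b.coord j) = wedge k _ f g := by
      intro f g
      conv_rhs => rw [← expand f, ← expand g]
      simp only [map_sum, LinearMap.sum_apply, map_smul, LinearMap.smul_apply, mul_smul]
      rw [Finset.sum_comm]
      refine Finset.sum_congr rfl fun i _ => ?_
      rw [Finset.smul_sum]
      exact Finset.sum_congr rfl fun j _ => smul_comm _ _ _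
    have e2 : ∑ i, ∑ j, (f (b j) * g (b i)) •
        wedge k _ (b.coord i) (b.coord j) = wedge k _ g f := by
      rw [← e1 g f]
      simp only [mul_comm]
    rw [e1, e2, wedge_swap g f, two_smul, sub_neg_eq_add]
  rw [injective_iff_map_eq_zero]
  intro w hw
  have := LinearMap.congr_fun h w
  simp only [LinearMap.smul_apply, LinearMap.id_apply, LinearMap.sum_apply,
      LinearMap.smulRight_apply, LinearMap.comp_apply, LinearMap.applyₗ_apply_apply, hw,
      LinearMap.zero_apply, zero_smul, Finset.sum_const_zero] at this
  exact (smul_eq_zero.mp this).resolve_left two_ne_zero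

end Wedge

/-! ## Bases adapted to a subspace of the dual -/

section Adapted

variable {k V : Type*} [Field k] [AddCommGroup V] [Module k V]

/-- A basis `a` of `U ⊆ V^∨` with a dual family `e` in `V`. -/
structure AdaptedBasis (U : Submodule k (Dual k V)) (n : ℕ) where
  a : Fin n → Dual k V
  e : Fin n → V
  mem : ∀ i, a i ∈ U
  apply_e : ∀ i j, a i (e j) = if i = j then 1 else 0
  sub_mem : ∀ v, v - ∑ i, a i v • e i ∈ U.dualCoannihilator

theorem exists_adaptedBasis [FiniteDimensional k V] (U : Submodule k (Dual k V)) :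
    ∃ n, Nonempty (AdaptedBasis U n) := by
  set W := U.dualCoannihilator
  set b := finBasis k (V ⧸ W)
  choose e he using fun i => W.mkQ_surjective (b i)
  refine ⟨_, ⟨⟨fun i => b.coord i ∘ₗ W.mkQ, e, fun i => ?_, fun i j => ?_, fun v => ?_⟩⟩⟩
  -- A functional on `V` that factors through `V ⧸ U^⊥` lies in `U`, by biduality in finite
  -- dimension.
  · rw [← Subspace.dualCoannihilator_dualAnnihilator_eq (W := U), Submodule.mem_dualAnnihilator]
    intro x hx
    simp [W, (Submodule.Quotient.mk_eq_zero W).mpr hx]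
  · rw [LinearMap.comp_apply, he, Basis.coord_apply, Basis.repr_self, Finsupp.single_apply]
    simp [eq_comm]
  · refine (Submodule.Quotient.mk_eq_zero W).mp ?_
    change W.mkQ _ = 0
    rw [map_sub, map_sum]
    simp only [map_smul, he, LinearMap.comp_apply, Basis.coord_apply]
    rw [b.sum_repr, sub_self]

variable {U : Submodule k (Dual k V)} {n : ℕ} (B : AdaptedBasis U n)

namespace AdaptedBasis

theorem a_apply_of_mem (i : Fin n) {x : V} (hx : x ∈ U.dualCoannihilator) : B.a i x = 0 :=
  (Submodule.mem_dualCoannihilator _).mp hx _ (B.mem i)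

theorem eq_sum {c : Dual k V} (hc : c ∈ U) : c = ∑ i, c (B.e i) • B.a i := by
  ext v
  have := (Submodule.mem_dualCoannihilator _).mp (B.sub_mem v) c hc
  rw [map_sub, map_sum, sub_eq_zero] at this
  simp [this, mul_comm]

theorem exists_ne (B : AdaptedBasis U n) (h : ∀ u : Dual k V, ¬ U ≤ k ∙ u) (i : Fin n) : ∃ j, j ≠ i := by
  by_contra! H
  refine h (B.a i) fun c hc => ?_
  rw [B.eq_sum hc]
  refine Submodule.sum_mem _ fun j _ => ?_
  rw [H j]
  exact Submodule.smul_mem _ _ (Submodule.mem_span_singleton_self _)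

theorem nonempty (B : AdaptedBasis U n) (h : ∀ u : Dual k V, ¬ U ≤ k ∙ u) : Nonempty (Fin n) := by
  by_contra! H
  refine h 0 fun c hc => ?_
  rw [B.eq_sum hc]
  simp

/-- The projection of `V` onto the span of the dual family. -/
def proj : V →ₗ[k] V := ∑ i, (B.a i).smulRight (B.e i)

theorem proj_apply (v : V) : B.proj v = ∑ i, B.a i v • B.e i := by simp [proj]

/-- The coefficients of a functional on `⋀² V` vanishing on `⋀² U^⊥`. -/
def coeff (φ : ⋀[k]^2 V →ₗ[k] k) (i : Fin n) : Dual k V :=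
  φ ∘ₗ wedge k V (B.e i) ∘ₗ (LinearMap.id - (2⁻¹ : k) • B.proj)

/-- Expand `φ((v - Pv) ∧ (w - Pw)) = 0`, with `P` the projection `B.proj`. The term `φ(Pv ∧ Pw)` is
shared equally between the two halves of the sum, which explains the `2⁻¹` in `coeff`. -/
theorem apply_wedge_eq [CharZero k] {φ : ⋀[k]^2 V →ₗ[k] k}
    (hφ : ∀ x ∈ U.dualCoannihilator, ∀ y ∈ U.dualCoannihilator, φ (wedge k V x y) = 0) (v w : V) :
    φ (wedge k V v w) = ∑ i, (B.a i v * B.coeff φ i w - B.a i w * B.coeff φ i v) := by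
  have h1 : ∀ v w, ∑ i, B.a i v * B.coeff φ i w =
      φ (wedge k V (B.proj v) (w - (2⁻¹ : k) • B.proj w)) := by
    intro v w
    rw [B.proj_apply v]
    simp [coeff, LinearMap.sum_apply]
  rw [Finset.sum_sub_distrib, h1, h1]
  have h2 := hφ _ (B.sub_mem v) _ (B.sub_mem w)
  rw [← B.proj_apply, ← B.proj_apply] at h2
  simp only [map_sub, LinearMap.sub_apply, map_smul] at h2 ⊢
  rw [wedge_swap (B.proj w) v, wedge_swap (B.proj w) (B.proj v)]
  simp only [map_neg, smul_eq_mul] 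
  have h3 : (2 : k)⁻¹ + 2⁻¹ = 1 := by rw [← two_mul]; exact mul_inv_cancel₀ two_ne_zero
  linear_combination h2 + φ (wedge k V (B.proj v) (B.proj w)) * h3

theorem apply_wedge_eq_pairingDual [CharZero k] {φ : ⋀[k]^2 V →ₗ[k] k}
    (hφ : ∀ x ∈ U.dualCoannihilator, ∀ y ∈ U.dualCoannihilator, φ (wedge k V x y) = 0) :
    φ = exteriorPower.pairingDual k V 2 (∑ i, wedge k _ (B.a i) (B.coeff φ i)) := by
  refine wedge_hom_ext fun v w => ?_
  rw [B.apply_wedge_eq hφ, map_sum, LinearMap.sum_apply]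
  simp only [pairingDual_wedge]

end AdaptedBasis

variable [CharZero k] [FiniteDimensional k V]

/-- In the expression `w = ∑ a_i ∧ g_i`, vanishing on `V ∧ U^⊥` makes each `g_i` vanish on `U^⊥`, so
`g_i ∈ U` by biduality. -/
theorem mem_wedgeSq_of_pairingDual {w : ⋀[k]^2 (Dual k V)}
    (hw : ∀ v, ∀ x ∈ U.dualCoannihilator,
      exteriorPower.pairingDual k V 2 w (wedge k V v x) = 0) : w ∈ wedgeSq U := by
  obtain ⟨n, ⟨B⟩⟩ := exists_adaptedBasis U
  rw [pairingDual_injective (B.apply_wedge_eq_pairingDual fun x _ y hy => hw x y hy)]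
  refine Submodule.sum_mem _ fun i _ => wedge_mem_wedgeSq (B.mem i) ?_
  refine (Subspace.dualCoannihilator_dualAnnihilator_eq (W := U)).le ?_
  rw [Submodule.mem_dualAnnihilator]
  intro x hx
  have : B.proj x = 0 := by
    rw [B.proj_apply]
    exact Finset.sum_eq_zero fun i _ => by rw [B.a_apply_of_mem i hx, zero_smul]
  simp [AdaptedBasis.coeff, this, hw _ x hx]

/-- The dual form of separability. -/
theorem IsSeparable.wedge_mem {K : Submodule k (⋀[k]^2 V)} (h : IsSeparable K U) (v : V) {x : V}
    (hx : x ∈ U.dualCoannihilator) :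
    wedge k V v x ∈ K ⊔ Submodule.span k
      {z | ∃ p ∈ U.dualCoannihilator, ∃ q ∈ U.dualCoannihilator, wedge k V p q = z} := by
  by_contra H
  -- A functional separating `v ∧ x` from the sum comes from an element of `K^⊥ ∩ ⟨U⟩`. Separability
  -- puts that element in `⋀² U`, which pairs to zero with `v ∧ x`.
  obtain ⟨φ, hφ, hφ'⟩ := Submodule.exists_le_ker_of_notMem H
  rw [sup_le_iff] at hφ'
  obtain ⟨n, ⟨B⟩⟩ := exists_adaptedBasis U
  have h1 := B.apply_wedge_eq_pairingDual
    fun x hx y hy => hφ'.2 (Submodule.subset_span ⟨x, hx, y, hy, rfl⟩)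
  have h2 := h (∑ i, wedge k _ (B.a i) (B.coeff φ i))
    (mem_perp.mpr fun x hx => by rw [← h1]; exact hφ'.1 hx)
    (by
      rw [Submodule.coe_sum]
      exact sum_mem fun i _ => wedge_mem_span (B.mem i))
  have h3 : wedgeSq U ≤ LinearMap.ker
      (LinearMap.applyₗ (wedge k V v x) ∘ₗ exteriorPower.pairingDual k V 2) := by
    refine wedgeSq_le fun a ha b hb => ?_
    simp [pairingDual_wedge, (Submodule.mem_dualCoannihilator _).mp hx a ha,
      (Submodule.mem_dualCoannihilator _).mp hx b hb]
  have h4 : exteriorPower.pairingDual k V 2 (∑ i, wedge k _ (B.a i) (B.coeff φ i))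
    (wedge k V v x) = 0 := h3 h2
  rw [← h1] at h4
  exact hφ h4

end Adapted

/-! ## Annihilators of Koszul modules -/

section SymmAlg

variable {k V : Type*} [Field k] [AddCommGroup V] [Module k V]

instance : IsDomain (SymmAlg k V) := inferInstanceAs (IsDomain (SymmetricAlgebra k V))

instance [FiniteDimensional k V] : Algebra.FiniteType k (SymmAlg k V) :=
  Algebra.FiniteType.equiv (inferInstanceAs (Algebra.FiniteType k (MvPolynomial _ k)))
    (SymmetricAlgebra.equivMvPolynomial (Module.finBasis k V)).symm

instance [FiniteDimensional k V] : IsNoetherianRing (SymmAlg k V) :=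
  Algebra.FiniteType.isNoetherianRing k _

/-- The restriction `Sym V → Sym (V ⧸ U^⊥)` of polynomial functions from `V^∨` to `U`. -/
def res (U : Submodule k (Dual k V)) :
    SymmAlg k V →ₐ[k] SymmAlg k (V ⧸ U.dualCoannihilator) :=
  symLift (symι k _ ∘ₗ U.dualCoannihilator.mkQ)

theorem res_ι (U : Submodule k (Dual k V)) (v : V) :
    res U (symι k V v) = symι k _ (U.dualCoannihilator.mkQ v) := symLift_ι _ _

theorem res_ι_of_mem {U : Submodule k (Dual k V)} {x : V} (hx : x ∈ U.dualCoannihilator) :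
    res U (symι k V x) = 0 := by
  rw [res_ι, Submodule.mkQ_apply, (Submodule.Quotient.mk_eq_zero _).mpr hx, map_zero]

/-- The prime ideal of `Sym V` of the polynomial functions that vanish on `U`. -/
def linearIdeal (U : Submodule k (Dual k V)) : Ideal (SymmAlg k V) := RingHom.ker (res U)

instance (U : Submodule k (Dual k V)) : (linearIdeal U).IsPrime := RingHom.ker_isPrime _

theorem mem_linearIdeal {U : Submodule k (Dual k V)} {s : SymmAlg k V} :
    s ∈ linearIdeal U ↔ res U s = 0 := Iff.rfl

/-- The quotient map `S → S ⧸ q` factors through `Sym (V ⧸ U^⊥)` as soon as `q` contains `U^⊥`. In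
effect, `linearIdeal U` is generated by linear forms. -/
theorem linearIdeal_le_iff {U : Submodule k (Dual k V)} {q : Ideal (SymmAlg k V)} :
    linearIdeal U ≤ q ↔ ∀ x ∈ U.dualCoannihilator, symι k V x ∈ q := by
  refine ⟨fun h x hx => h (res_ι_of_mem hx), fun h s hs => ?_⟩
  let g : SymmAlg k (V ⧸ U.dualCoannihilator) →ₐ[k] SymmAlg k V ⧸ q :=
    symLift (U.dualCoannihilator.liftQ ((Ideal.Quotient.mkₐ k q).toLinearMap ∘ₗ symι k V)
      (show _ ≤ LinearMap.ker _ from fun x hx => Ideal.Quotient.eq_zero_iff_mem.mpr (h x hx)))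
  have hg : g.comp (res U) = Ideal.Quotient.mkₐ k q := by
    refine symAlgHom_ext k V fun v => ?_
    rw [AlgHom.comp_apply, res_ι, symLift_ι, Submodule.mkQ_apply, Submodule.liftQ_apply]
    rfl
  have := AlgHom.congr_fun hg s
  rw [AlgHom.comp_apply, mem_linearIdeal.mp hs, map_zero] at this
  exact Ideal.Quotient.eq_zero_iff_mem.mp this.symm

/-- The homomorphism `s ↦ s|_U + ε ∂_g s` to the dual numbers. -/
def resDual (U : Submodule k (Dual k V)) (g : Dual k V) :
    SymmAlg k V →ₐ[k] DualNumber (SymmAlg k (V ⧸ U.dualCoannihilator)) :=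
  symLift ((TrivSqZeroExt.inlAlgHom k _ _).toLinearMap ∘ₗ (res U).toLinearMap ∘ₗ symι k V +
    (TrivSqZeroExt.inrHom _ _).restrictScalars k ∘ₗ Algebra.linearMap k _ ∘ₗ g)

/-- The derivative of a polynomial function in the direction `g`, restricted to `U`. -/
def resDeriv (U : Submodule k (Dual k V)) (g : Dual k V) :
    SymmAlg k V →ₗ[k] SymmAlg k (V ⧸ U.dualCoannihilator) :=
  (TrivSqZeroExt.sndHom (SymmAlg k (V ⧸ U.dualCoannihilator))
    (SymmAlg k (V ⧸ U.dualCoannihilator))).restrictScalars k ∘ₗ (resDual U g).toLinearMap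

theorem resDeriv_ι (U : Submodule k (Dual k V)) (g : Dual k V) (v : V) :
    resDeriv U g (symι k V v) = algebraMap k _ (g v) := by
  simp [resDeriv, resDual, symLift_ι, Algebra.algebraMap_eq_smul_one]

theorem fst_resDual (U : Submodule k (Dual k V)) (g : Dual k V) (s : SymmAlg k V) :
    (resDual U g s).fst = res U s := by
  have : (TrivSqZeroExt.fstHom k _ _).comp (resDual U g) = res U := by
    refine symAlgHom_ext k V fun v => ?_
    simp [resDual, symLift_ι]
  exact AlgHom.congr_fun this s

theorem resDeriv_mul (U : Submodule k (Dual k V)) (g : Dual k V) (s t : SymmAlg k V) :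
    resDeriv U g (s * t) = res U s * resDeriv U g t + res U t * resDeriv U g s := by
  change (resDual U g (s * t)).snd = _
  rw [map_mul, TrivSqZeroExt.snd_mul, fst_resDual, fst_resDual, op_smul_eq_smul]
  rfl

end SymmAlg

/-! ### The Koszul complex along an isotropic subspace -/

section Annihilator

variable {k V : Type*} [Field k] [AddCommGroup V] [Module k V] {U : Submodule k (Dual k V)}
  {K : Submodule k (⋀[k]^2 V)} {n : ℕ}

theorem δ₁_tmul (s : SymmAlg k V) (v : V) : δ₁ k V (s ⊗ₜ v) = s * symι k V v := by
  rw [δ₁, LinearMap.liftBaseChange_tmul, smul_eq_mul]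

theorem δ₂_tmul_wedge (s : SymmAlg k V) (v w : V) :
    δ₂ k V (s ⊗ₜ wedge k V v w) = (s * symι k V v) ⊗ₜ w - (s * symι k V w) ⊗ₜ v := by
  rw [wedge_apply, δ₂_tmul]
  rfl

theorem δ₁_δ₂_wedge (v w : V) : δ₁ k V (δ₂ k V (1 ⊗ₜ wedge k V v w)) = 0 := by
  rw [δ₂_tmul_wedge, map_sub, δ₁_tmul, δ₁_tmul]
  ring

theorem δ₂K_tmul (s : SymmAlg k V) (x : K) : δ₂K K (s ⊗ₜ x) = δ₂ k V (s ⊗ₜ (x : ⋀[k]^2 V)) := rfl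

/-- A functional on `S ⊗ V` given by `s ⊗ v ↦ ∑ i, a i v • D i s`. -/
def AdaptedBasis.contract (B : AdaptedBasis U n)
    (D : Fin n → SymmAlg k V →ₗ[k] SymmAlg k (V ⧸ U.dualCoannihilator)) :
    SymmAlg k V ⊗[k] V →ₗ[k] SymmAlg k (V ⧸ U.dualCoannihilator) :=
  ∑ i, TensorProduct.lift ((LinearMap.lsmul k _).flip.compl₁₂ (D i) (B.a i))

theorem AdaptedBasis.contract_tmul (B : AdaptedBasis U n)
    (D : Fin n → SymmAlg k V →ₗ[k] SymmAlg k (V ⧸ U.dualCoannihilator)) (s : SymmAlg k V) (v : V) :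
    B.contract D (s ⊗ₜ v) = ∑ i, B.a i v • D i s := by
  simp [contract, LinearMap.sum_apply]

theorem AdaptedBasis.res_ι_eq (B : AdaptedBasis U n) (v : V) :
    res U (symι k V v) = ∑ i, B.a i v • res U (symι k V (B.e i)) := by
  have := res_ι_of_mem (B.sub_mem v)
  rw [map_sub, map_sub, sub_eq_zero, map_sum, map_sum] at this
  simpa only [map_smul] using this

/-- For fixed `s`, the composite on `⋀² V` is a combination of the pairings with `a_j ∧ a_i` and
with `∑ a_i ∧ g_i`. The former vanish on `K` by isotropy, the latter by `hg`. Taking `g = 0` gives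
the zeroth-order test functionals, and taking derivatives for `D` the first-order ones. -/
theorem AdaptedBasis.contract_δ₂K (B : AdaptedBasis U n) (hU : IsIsotropic K U)
    (D : Fin n → SymmAlg k V →ₗ[k] SymmAlg k (V ⧸ U.dualCoannihilator)) (g : Fin n → Dual k V)
    (hD : ∀ i s v, D i (s * symι k V v) = res U (symι k V v) * D i s + g i v • res U s)
    (hg : ∑ i, wedge k _ (B.a i) (g i) ∈ perp K) (z : SymmAlg k V ⊗[k] K) :
    B.contract D (δ₂K K z) = 0 := by
  induction z with
  | zero => simp
  | add x y hx hy => rw [map_add, map_add, hx, hy, add_zero]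
  | tmul s x =>
    have h : B.contract D ∘ₗ (δ₂ k V).restrictScalars k ∘ₗ TensorProduct.mk k _ _ s =
        (∑ i, ∑ j, (exteriorPower.pairingDual k V 2 (wedge k _ (B.a j) (B.a i))).smulRight
          (res U (symι k V (B.e j)) * D i s)) -
        (exteriorPower.pairingDual k V 2 (∑ i, wedge k _ (B.a i) (g i))).smulRight (res U s) := by
      refine wedge_hom_ext fun v w => ?_
      simp only [LinearMap.comp_apply, TensorProduct.mk_apply, LinearMap.coe_restrictScalars,
        δ₂_tmul_wedge, map_sub, B.contract_tmul, hD, LinearMap.sub_apply, LinearMap.sum_apply,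
        LinearMap.smulRight_apply, map_sum, pairingDual_wedge]
      have h1 : ∀ v w i, B.a i w • (res U (symι k V v) * D i s) =
          ∑ j, (B.a j v * B.a i w) • (res U (symι k V (B.e j)) * D i s) := by
        intro v w i
        rw [B.res_ι_eq v, Finset.sum_mul, Finset.smul_sum]
        refine Finset.sum_congr rfl fun j _ => ?_
        rw [smul_mul_assoc, smul_smul, mul_comm]
      simp only [smul_add, h1, sub_smul, Finset.sum_sub_distrib, Finset.sum_add_distrib,
        Finset.sum_smul, smul_smul]
      abel
    have h2 := LinearMap.congr_fun h (x : ⋀[k]^2 V)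
    simp only [LinearMap.comp_apply, TensorProduct.mk_apply, LinearMap.coe_restrictScalars,
      LinearMap.sub_apply, LinearMap.sum_apply, LinearMap.smulRight_apply] at h2
    rw [δ₂K_tmul, h2, mem_perp.mp hg x x.2, zero_smul, sub_zero]
    refine Finset.sum_eq_zero fun i _ => Finset.sum_eq_zero fun j _ => ?_
    rw [mem_perp.mp (isIsotropic_iff.mp hU _ (B.mem j) _ (B.mem i)) x x.2, zero_smul]

/-- The coordinate function `e i` of `U`, as an evaluation on polynomial functions. -/
def AdaptedBasis.coord (B : AdaptedBasis U n) (i : Fin n) :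
    SymmAlg k (V ⧸ U.dualCoannihilator) →ₐ[k] k :=
  symLift (U.dualCoannihilator.liftQ (B.a i)
    (show _ ≤ LinearMap.ker _ from fun _ hx => B.a_apply_of_mem i hx))

theorem AdaptedBasis.coord_res_ι (B : AdaptedBasis U n) (i : Fin n) (v : V) :
    B.coord i (res U (symι k V v)) = B.a i v := by
  rw [coord, res_ι, symLift_ι, Submodule.mkQ_apply, Submodule.liftQ_apply]

theorem AdaptedBasis.res_ι_e_ne_zero (B : AdaptedBasis U n) (i : Fin n) :
    res U (symι k V (B.e i)) ≠ 0 := by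
  intro h
  have h1 := B.coord_res_ι i (B.e i)
  rw [h, map_zero, B.apply_e, if_pos rfl] at h1
  exact zero_ne_one h1

/-- The annihilator of the Koszul module vanishes on isotropic subspaces of dimension at least
two. -/
theorem resIdeal_le_linearIdeal [FiniteDimensional k V] (hU : IsIsotropic K U)
    (h2 : ∀ u : Dual k V, ¬ U ≤ k ∙ u) : resIdeal K ≤ linearIdeal U := by
  intro f hf
  obtain ⟨n, ⟨B⟩⟩ := exists_adaptedBasis U
  obtain ⟨i⟩ := B.nonempty h2
  obtain ⟨j, hij⟩ := B.exists_ne h2 i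
  obtain ⟨z, hz⟩ := (mem_resIdeal K f).mp hf _ (δ₁_δ₂_wedge (B.e j) (B.e i))
  -- Only the `i`-th slot is read off, so the cycle of `e_j ∧ e_i` multiplied by `f` contributes
  -- `f|_U · e_j|_U`. This lies in a domain, where `e_j|_U ≠ 0`.
  have h := B.contract_δ₂K hU (fun l => if l = i then (res U).toLinearMap else 0) (fun _ => 0)
    (fun l s v => by split_ifs <;> simp [mul_comm]) (by simp) z
  rw [hz, δ₂_tmul_wedge, smul_sub, TensorProduct.smul_tmul', TensorProduct.smul_tmul', map_sub,
    B.contract_tmul, B.contract_tmul, Finset.sum_eq_single i (by intro b _ hb; simp [hb]) (by simp),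
    Finset.sum_eq_single i (by intro b _ hb; simp [hb]) (by simp), B.apply_e, B.apply_e,
    if_pos rfl, if_neg hij.symm] at h
  simp only [if_true, one_smul, zero_smul, sub_zero, one_mul, smul_eq_mul,
    AlgHom.toLinearMap_apply, map_mul] at h
  exact (mul_eq_zero.mp h).resolve_right (B.res_ι_e_ne_zero j)

/-- If the ideals of `U` and of the resonance scheme agree generically on `U`, then `U` is
separable. -/
theorem isSeparable_of_exists_mul_mem [CharZero k] [FiniteDimensional k V] (hU : IsIsotropic K U)
    (h2 : ∀ u : Dual k V, ¬ U ≤ k ∙ u)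
    (h : ∀ x ∈ U.dualCoannihilator, ∃ f ∉ linearIdeal U, f * symι k V x ∈ resIdeal K) :
    IsSeparable K U := by
  intro w hw hwU
  set φ := exteriorPower.pairingDual k V 2 w
  obtain ⟨n, ⟨B⟩⟩ := exists_adaptedBasis U
  have hφ : ∀ x ∈ U.dualCoannihilator, ∀ y ∈ U.dualCoannihilator, φ (wedge k V x y) = 0 :=
    fun x hx y hy => pairingDual_eq_zero_of_mem_span hwU hx hy
  have hwB : w = ∑ i, wedge k _ (B.a i) (B.coeff φ i) :=
    pairingDual_injective (B.apply_wedge_eq_pairingDual hφ)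
  have key : ∀ x ∈ U.dualCoannihilator, ∀ i, B.coeff φ i x = 0 := by
    intro x hx i
    obtain ⟨j, hij⟩ := B.exists_ne h2 i
    obtain ⟨f, hf, hfx⟩ := h x hx
    obtain ⟨z, hz⟩ := (mem_resIdeal K _).mp hfx _ (δ₁_δ₂_wedge (B.e j) (B.e i))
    -- Since `x` vanishes on `U`, only its own derivative survives. With `g_l = B.coeff φ l` the
    -- outcome is `f|_U · (g_i(x) e_j - g_j(x) e_i)|_U = 0`. After cancelling `f|_U`, evaluation at
    -- `a_j` isolates `g_i(x)`.
    have h := B.contract_δ₂K hU (fun l => resDeriv U (B.coeff φ l)) (fun l => B.coeff φ l)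
      (fun l s v => by
        rw [resDeriv_mul, resDeriv_ι, Algebra.smul_def]
        ring) (hwB ▸ hw) z
    have hD : ∀ v l, resDeriv U (B.coeff φ l) (f * symι k V x * symι k V v) =
        B.coeff φ l x • (res U f * res U (symι k V v)) := by
      intro v l
      rw [mul_right_comm, resDeriv_mul, res_ι_of_mem hx, zero_mul, add_zero, resDeriv_ι, map_mul,
        Algebra.smul_def, mul_comm]
    rw [hz, δ₂_tmul_wedge, smul_sub, TensorProduct.smul_tmul', TensorProduct.smul_tmul', map_sub,
      B.contract_tmul, B.contract_tmul] at h
    simp only [one_mul, smul_eq_mul, hD, B.apply_e, ite_smul, one_smul, zero_smul,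
      Finset.sum_ite_eq', Finset.mem_univ, if_true] at h
    rw [mul_comm, mul_comm (res U f), ← smul_mul_assoc, ← smul_mul_assoc, ← sub_mul] at h
    have h1 := (mul_eq_zero.mp h).resolve_right hf
    have h3 := congrArg (B.coord j) h1
    rw [map_sub, map_smul, map_smul, B.coord_res_ι, B.coord_res_ι, B.apply_e, B.apply_e,
      if_pos rfl, if_neg hij, map_zero] at h3
    simpa using h3
  refine mem_wedgeSq_of_pairingDual fun v x hx => ?_
  change φ _ = 0
  rw [B.apply_wedge_eq hφ]
  refine Finset.sum_eq_zero fun i _ => ?_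
  rw [key x hx, B.a_apply_of_mem i hx, mul_zero, zero_mul, sub_zero]

/-- This is `δ₂ ∘ δ₃ = 0` in the Koszul complex. Modulo the image of `S ⊗ K` it lets a linear form
be exchanged with a factor of a wedge. -/
theorem δ₂_wedge_cocycle (u v w : V) :
    symι k V u • δ₂ k V (1 ⊗ₜ wedge k V v w) - symι k V v • δ₂ k V (1 ⊗ₜ wedge k V u w) +
      symι k V w • δ₂ k V (1 ⊗ₜ wedge k V u v) = 0 := by
  simp only [δ₂_tmul_wedge, smul_sub, TensorProduct.smul_tmul', smul_eq_mul, one_mul,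
    mul_comm (symι k V u) (symι k V v), mul_comm (symι k V u) (symι k V w),
    mul_comm (symι k V v) (symι k V w)]
  abel

variable (k V) in
/-- The Koszul boundaries in `S ⊗ V`. -/
def boundaries : Submodule (SymmAlg k V) (SymmAlg k V ⊗[k] V) :=
  Submodule.span _ {z | ∃ v w : V, δ₂ k V (1 ⊗ₜ wedge k V v w) = z}

/-- Cycles are boundaries up to multiplication by a linear form. -/
theorem smul_mem_boundaries (x : V) {z : SymmAlg k V ⊗[k] V} (hz : δ₁ k V z = 0) :
    symι k V x • z ∈ boundaries k V := by
  -- Wedging with `x` is a contracting homotopy up to multiplication by `x`: on `s ⊗ v` the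
  -- difference equals `s • δ₂ (x ∧ v)`.
  have h : ∀ z, symι k V x • z - δ₁ k V z ⊗ₜ x ∈ boundaries k V := by
    intro z
    induction z with
    | zero => simp
    | add y z hy hz =>
      rw [smul_add, map_add, TensorProduct.add_tmul, add_sub_add_comm]
      exact add_mem hy hz
    | tmul s v =>
      have h1 : s • δ₂ k V (1 ⊗ₜ wedge k V x v) ∈ boundaries k V :=
        Submodule.smul_mem _ _ (Submodule.subset_span ⟨x, v, rfl⟩)
      rw [δ₂_tmul_wedge, smul_sub, TensorProduct.smul_tmul', TensorProduct.smul_tmul'] at h1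
      simpa only [one_mul, smul_eq_mul, δ₁_tmul, TensorProduct.smul_tmul', mul_comm s] using h1
  simpa [hz] using h z

/-- A version of Nakayama's lemma. -/
theorem exists_notMem_smul_eq_zero {R M : Type*} [CommRing R] [AddCommGroup M] [Module R M]
    (N : Submodule R M) (hN : N.FG) (q : Ideal R) [q.IsPrime] {r : R} (hr : r ∉ q)
    (h : ∀ x ∈ N, r • x ∈ q • N) : ∃ f ∉ q, ∀ x ∈ N, f • x = 0 := by
  have : Module.Finite R N := Module.Finite.iff_fg.mpr hN
  have hrange : LinearMap.range (r • LinearMap.id : N →ₗ[R] N) ≤ q • ⊤ := by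
    rintro _ ⟨x, rfl⟩
    rw [Submodule.mem_smul_top_iff]
    exact h x x.2
  -- Cayley–Hamilton for multiplication by `r`. Modulo `q` the value `p(r)` is a power of `r`, so it
  -- is not in `q`.
  obtain ⟨p, hp, -, hpq, hpr⟩ :=
    LinearMap.exists_monic_and_natDegree_eq_and_coeff_mem_pow_and_aeval_eq_zero R _ q hrange
  refine ⟨p.eval r, fun hq => hr ?_, fun x hx => ?_⟩
  · rw [Polynomial.eval_eq_sum_range, Finset.sum_range_succ, hp.coeff_natDegree, one_mul] at hq
    refine Ideal.IsPrime.mem_of_pow_mem ‹_› p.natDegree ((Ideal.add_mem_iff_right _ ?_).mp hq)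
    refine Ideal.sum_mem _ fun i hi => Ideal.mul_mem_right _ _ ?_
    exact Ideal.pow_le_self (Nat.sub_ne_zero_of_lt (Finset.mem_range.mp hi)) (hpq i)
  · have h1 := LinearMap.congr_fun hpr ⟨x, hx⟩
    have h2 : (r • LinearMap.id : N →ₗ[R] N) = algebraMap R (Module.End R N) r := by
      ext; simp
    rw [h2, Polynomial.aeval_algebraMap_apply, Polynomial.coe_aeval_eq_eval] at h1
    exact congrArg Subtype.val h1

/-- Along a separable subspace, the resonance scheme is contained in that subspace. -/
theorem IsSeparable.exists_mul_mem [CharZero k] [FiniteDimensional k V] (hU : IsSeparable K U)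
    (q : Ideal (SymmAlg k V)) [q.IsPrime] (hq : linearIdeal U ≤ q) {y : V} (hy : symι k V y ∉ q) :
    ∃ f ∉ q, ∀ x ∈ U.dualCoannihilator, f * symι k V x ∈ resIdeal K := by
  set W := U.dualCoannihilator
  set Q := LinearMap.range (δ₂K K)
  let c : ⋀[k]^2 V →ₗ[k] (SymmAlg k V ⊗[k] V) ⧸ Q :=
    (Q.mkQ ∘ₗ δ₂ k V).restrictScalars k ∘ₗ TensorProduct.mk k _ _ 1
  have hcK : ∀ x ∈ K, c x = 0 := fun x hx =>
    (Submodule.Quotient.mk_eq_zero Q).mpr ⟨1 ⊗ₜ ⟨x, hx⟩, δ₂K_tmul _ _⟩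
  have hc : ∀ u v w, symι k V u • c (wedge k V v w) = symι k V v • c (wedge k V u w) -
      symι k V w • c (wedge k V u v) := by
    intro u v w
    have h := congrArg Q.mkQ (δ₂_wedge_cocycle u v w)
    rw [map_add, map_sub, map_smul, map_smul, map_smul, map_zero] at h
    rw [← sub_eq_zero, ← h]
    change symι k V u • Q.mkQ _ - (symι k V v • Q.mkQ _ - symι k V w • Q.mkQ _) = _
    abel
  -- Since `y` is invertible at `q`, it suffices to control the classes of `y ∧ x` with `x ∈ U^⊥`.
  set N : Submodule (SymmAlg k V) ((SymmAlg k V ⊗[k] V) ⧸ Q) :=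
    Submodule.span _ (W.map (c ∘ₗ wedge k V y) : Set ((SymmAlg k V ⊗[k] V) ⧸ Q))
  have hcN : ∀ x ∈ W, c (wedge k V y x) ∈ N := fun x hx => Submodule.subset_span ⟨x, hx, rfl⟩
  have hN : N.FG := by
    obtain ⟨s, hs⟩ := (IsNoetherian.noetherian W).map (c ∘ₗ wedge k V y)
    refine ⟨s, ?_⟩
    rw [← Submodule.span_span_of_tower k (SymmAlg k V), hs]
  have hpq : ∀ v, ∀ x ∈ W, symι k V y • c (wedge k V v x) ∈ q • N := by
    intro v x hx
    -- The class of `K` is zero. On `⋀² U^⊥` the cocycle relation moves `p` and `r`, both in `q`,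
    -- out as coefficients.
    have h1 : K ⊔ Submodule.span k {z | ∃ p ∈ W, ∃ q ∈ W, wedge k V p q = z} ≤
        ((q • N).restrictScalars k).comap (symι k V y • c) := by
      refine sup_le (fun x hx => ?_) (Submodule.span_le.mpr ?_)
      · simp [hcK x hx]
      · rintro _ ⟨p, hp, r, hr, rfl⟩
        have hmem := fun x hx => linearIdeal_le_iff.mp hq x hx
        change symι k V y • c (wedge k V p r) ∈ q • N
        rw [hc]
        exact sub_mem (Submodule.smul_mem_smul (hmem p hp) (hcN r hr))
          (Submodule.smul_mem_smul (hmem r hr) (hcN p hp))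
    exact h1 (hU.wedge_mem v hx)
  obtain ⟨f, hf, hfN⟩ := exists_notMem_smul_eq_zero N hN q hy fun x hx => by
    induction hx using Submodule.span_induction with
    | mem x hx =>
      obtain ⟨x, hx, rfl⟩ := hx
      exact hpq y x hx
    | zero => simp
    | add a b _ _ ha hb => rw [smul_add]; exact add_mem ha hb
    | smul s a _ ha => rw [smul_comm]; exact Submodule.smul_mem _ _ ha
  -- One factor `y` carries arbitrary classes `c (v ∧ x)` into `N`, and the other turns cycles into
  -- boundaries.
  refine ⟨f * symι k V y * symι k V y, fun h => ?_, fun x hx => ?_⟩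
  · rcases Ideal.IsPrime.mem_or_mem ‹_› h with h | h
    · exact (Ideal.IsPrime.mem_or_mem ‹_› h).elim hf hy
    · exact hy h
  have hf0 : ∀ w, f • symι k V y • c (wedge k V x w) = 0 := by
    intro w
    rw [wedge_swap, map_neg, smul_neg, smul_neg,
      hfN _ (Submodule.smul_le_right (hpq w x hx)), neg_zero]
  have hb : boundaries k V ≤ Q.comap (LinearMap.lsmul _ _ (f * symι k V y * symι k V x)) := by
    rw [boundaries, Submodule.span_le]
    rintro _ ⟨v, w, rfl⟩
    change (f * symι k V y * symι k V x) • _ ∈ Q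
    rw [← Submodule.Quotient.mk_eq_zero, Submodule.Quotient.mk_smul]
    change (f * symι k V y * symι k V x) • c (wedge k V v w) = 0
    rw [mul_smul, mul_smul, hc, smul_sub, smul_sub, smul_comm (symι k V y), smul_comm f, hf0,
      smul_comm (symι k V y), smul_comm f, hf0, smul_zero, smul_zero, sub_zero]
  rw [mem_resIdeal]
  intro z hz
  have h := hb (smul_mem_boundaries y hz)
  change (f * symι k V y * symι k V x) • symι k V y • z ∈ Q at h
  rwa [smul_smul, mul_right_comm] at h

/-- The support of the Koszul module is contained in the resonance variety. -/
theorem mem_resonance_of_resIdeal_le [FiniteDimensional k V] {a : Dual k V} (ha : a ≠ 0)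
    (h : resIdeal K ≤ RingHom.ker (symLift a : SymmAlg k V →ₐ[k] k)) : a ∈ resonance K := by
  set m := RingHom.ker (symLift a : SymmAlg k V →ₐ[k] k)
  by_contra hres
  obtain ⟨y, hy⟩ : ∃ y, a y = 1 := by
    obtain ⟨v, hv⟩ : ∃ v, a v ≠ 0 := by
      by_contra! H
      exact ha (LinearMap.ext H)
    exact ⟨(a v)⁻¹ • v, by simp [hv]⟩
  set Q := LinearMap.range (δ₂K K)
  set N := (boundaries k V).map Q.mkQ
  have hm : ∀ v, symι k V v - algebraMap k _ (a v) ∈ m := fun v => by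
    change symLift a _ = 0
    simp [symLift_ι]
  let c : ⋀[k]^2 V →ₗ[k] (SymmAlg k V ⊗[k] V) ⧸ Q :=
    (Q.mkQ ∘ₗ δ₂ k V).restrictScalars k ∘ₗ TensorProduct.mk k _ _ 1
  have hcN : ∀ v w, c (wedge k V v w) ∈ N := fun v w => ⟨_, Submodule.subset_span ⟨v, w, rfl⟩, rfl⟩
  set L : Submodule k (⋀[k]^2 V) := ((m • N).restrictScalars k).comap c
  have hKL : K ≤ L := fun x hx => by
    have : c x = 0 := (Submodule.Quotient.mk_eq_zero Q).mpr ⟨1 ⊗ₜ ⟨x, hx⟩, δ₂K_tmul _ _⟩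
    simp [L, this]
  -- Modulo `m` a linear form acts as its value at `a`. As `a y = 1`, the cocycle relation expresses
  -- every wedge through wedges with `y`.
  have hL : ∀ v w, wedge k V v w - a v • wedge k V y w + a w • wedge k V y v ∈ L := by
    intro v w
    change c _ ∈ m • N
    have hs : ∀ u x, a u • c x = symι k V u • c x -
        (symι k V u - algebraMap k _ (a u)) • c x := by
      intro u x
      rw [sub_smul, algebraMap_smul, sub_sub_cancel]
    have h0 := congrArg Q.mkQ (δ₂_wedge_cocycle y v w)
    rw [map_add, map_sub, map_smul, map_smul, map_smul, map_zero] at h0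
    have h1 : symι k V y • c (wedge k V v w) - symι k V v • c (wedge k V y w) +
      symι k V w • c (wedge k V y v) = 0 := h0
    have h2 : c (wedge k V v w - a v • wedge k V y w + a w • wedge k V y v) =
        -((symι k V y - algebraMap k _ (a y)) • c (wedge k V v w)) +
        (symι k V v - algebraMap k _ (a v)) • c (wedge k V y w) -
        (symι k V w - algebraMap k _ (a w)) • c (wedge k V y v) := by
      have e : c (wedge k V v w - a v • wedge k V y w + a w • wedge k V y v) =
          a y • c (wedge k V v w) - a v • c (wedge k V y w) + a w • c (wedge k V y v) := by
        rw [hy, one_smul]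
        simp only [map_add, map_sub, map_smul]
      rw [e, hs y, hs v, hs w, ← sub_eq_zero, ← h1]
      abel
    rw [h2]
    exact sub_mem (add_mem (neg_mem (Submodule.smul_mem_smul (hm _) (hcN _ _)))
      (Submodule.smul_mem_smul (hm _) (hcN _ _))) (Submodule.smul_mem_smul (hm _) (hcN _ _))
  have hLtop : L = ⊤ := by
    by_contra hL'
    obtain ⟨φ, hφ, hφL⟩ := Submodule.exists_le_ker_of_lt_top L (lt_top_iff_ne_top.mpr hL')
    -- By `hL`, a functional that kills `L` is the pairing with `a ∧ b` for `b = φ(y ∧ ·)`. Thus a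
    -- proper `L` would make `a` resonant.
    refine hres (Or.inl ⟨φ ∘ₗ wedge k V y, ?_⟩)
    have h1 : φ = exteriorPower.pairingDual k V 2 (wedge k _ a (φ ∘ₗ wedge k V y)) := by
      refine wedge_hom_ext fun v w => ?_
      have := hφL (hL v w)
      rw [LinearMap.mem_ker, map_add, map_sub, map_smul, map_smul] at this
      rw [pairingDual_wedge]
      simp only [LinearMap.comp_apply, smul_eq_mul] at this ⊢
      linear_combination this
    rw [← wedge_apply]
    refine ⟨mem_perp.mpr fun x hx => by rw [← h1]; exact hφL (hKL hx), fun h0 => hφ ?_⟩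
    rw [h1, h0, map_zero]
  have hNm : N ≤ m • N := by
    rw [Submodule.map_le_iff_le_comap, boundaries, Submodule.span_le]
    rintro _ ⟨v, w, rfl⟩
    exact (hLtop ▸ Submodule.mem_top : wedge k V v w ∈ L)
  have hN : N.FG := (IsNoetherian.noetherian (boundaries k V)).map _
  -- By Nakayama some `r` with value `1` at `a` kills the boundaries, so `r y` annihilates the
  -- Koszul module although its value at `a` is `1`.
  obtain ⟨r, hr, hrN⟩ := Submodule.exists_sub_one_mem_and_smul_eq_zero_of_fg_of_le_smul m N hN hNm
  have hrI : r * symι k V y ∈ resIdeal K := by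
    rw [mem_resIdeal]
    intro z hz
    rw [mul_smul, ← Submodule.Quotient.mk_eq_zero, Submodule.Quotient.mk_smul]
    exact hrN _ ⟨_, smul_mem_boundaries y hz, rfl⟩
  have h1 : symLift a (r * symι k V y) = 0 := h hrI
  have h2 : symLift a (r - 1) = 0 := hr
  rw [map_mul, symLift_ι, hy, mul_one] at h1
  rw [map_sub, h1, map_one] at h2
  simp at h2

end Annihilator

/-! ## Polynomial functions on the dual space -/

section Points

variable {k V : Type*} [Field k] [AddCommGroup V] [Module k V]

/-- The kernel of the evaluation `Sym V → k` at `a ∈ V^∨`. -/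
def evalIdeal (a : Dual k V) : Ideal (SymmAlg k V) :=
  RingHom.ker (symLift a : SymmAlg k V →ₐ[k] k)

instance (a : Dual k V) : (evalIdeal a).IsPrime := RingHom.ker_isPrime _

theorem mem_evalIdeal {a : Dual k V} {s : SymmAlg k V} : s ∈ evalIdeal a ↔ symLift a s = 0 :=
  Iff.rfl

theorem ι_mem_evalIdeal {a : Dual k V} {v : V} : symι k V v ∈ evalIdeal a ↔ a v = 0 := by
  rw [mem_evalIdeal, symLift_ι]

/-- The zero set in `V^∨` of an ideal of `Sym V`. -/
def zeros (q : Ideal (SymmAlg k V)) : Set (Dual k V) := {a | q ≤ evalIdeal a}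

theorem mem_zeros {q : Ideal (SymmAlg k V)} {a : Dual k V} : a ∈ zeros q ↔ q ≤ evalIdeal a :=
  Iff.rfl

theorem zeros_linearIdeal [FiniteDimensional k V] (U : Submodule k (Dual k V)) :
    zeros (linearIdeal U) = U := by
  ext a
  rw [mem_zeros, linearIdeal_le_iff, SetLike.mem_coe]
  conv_rhs => rw [← Subspace.dualCoannihilator_dualAnnihilator_eq (W := U),
    Submodule.mem_dualAnnihilator]
  simp only [ι_mem_evalIdeal]

/-- Hilbert's Nullstellensatz for prime ideals of `Sym V`. -/
theorem exists_mem_zeros_notMem [IsAlgClosed k] [FiniteDimensional k V] {q : Ideal (SymmAlg k V)}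
    [hq : q.IsPrime] {s : SymmAlg k V} (hs : s ∉ q) : ∃ a ∈ zeros q, s ∉ evalIdeal a := by
  have : IsJacobsonRing (SymmAlg k V) := isJacobsonRing_of_finiteType (A := k)
  rw [← IsJacobsonRing.out this hq.isRadical, Ideal.jacobson, Submodule.mem_sInf] at hs
  push Not at hs
  obtain ⟨m, ⟨hqm, hm⟩, hsm⟩ := hs
  let _ : Field (SymmAlg k V ⧸ m) := Ideal.Quotient.field m
  have : Module.Finite k (SymmAlg k V ⧸ m) := finite_of_finite_type_of_isJacobsonRing _ _
  -- The residue field is finite over the algebraically closed `k`, hence equal to it. So `m` is the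
  -- kernel of an evaluation.
  let e : k ≃ₐ[k] SymmAlg k V ⧸ m := AlgEquiv.ofBijective (Algebra.ofId k _)
    (IsAlgClosed.algebraMap_bijective_of_isIntegral (k := k) (K := SymmAlg k V ⧸ m))
  let F : SymmAlg k V →ₐ[k] k := (e.symm : _ →ₐ[k] k).comp (Ideal.Quotient.mkₐ k m)
  have hF : symLift (F.toLinearMap ∘ₗ symι k V) = F :=
    symAlgHom_ext k V fun v => by rw [symLift_ι]; rfl
  have hmF : evalIdeal (F.toLinearMap ∘ₗ symι k V) = m := by
    ext t
    rw [mem_evalIdeal, hF]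
    change e.symm _ = 0 ↔ _
    rw [map_eq_zero_iff _ e.symm.injective]
    exact Ideal.Quotient.eq_zero_iff_mem
  exact ⟨_, mem_zeros.mpr (hqm.trans hmF.ge), hmF ▸ hsm⟩

theorem le_of_zeros_subset [IsAlgClosed k] [FiniteDimensional k V] {p q : Ideal (SymmAlg k V)}
    [q.IsPrime] (h : zeros q ⊆ zeros p) : p ≤ q := by
  intro s hs
  by_contra hsq
  obtain ⟨a, ha, hsa⟩ := exists_mem_zeros_notMem hsq
  exact hsa (h ha hs)

/-- Two basic opens meeting the zero set come from `s, t ∉ q`. Then `s t ∉ q`, and the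
Nullstellensatz supplies a common point. -/
theorem isIrreducible_zeros [IsAlgClosed k] [FiniteDimensional k V] (q : Ideal (SymmAlg k V))
    [hq : q.IsPrime] : @IsIrreducible _ (zariski k V) (zeros q) := by
  let _ := zariski k V
  have key : ∀ u : Set (Dual k V), IsOpen u → ∀ a ∈ u, ∃ s, s ∉ evalIdeal a ∧
      ∀ b, s ∉ evalIdeal b → b ∈ u := by
    intro u hu a ha
    obtain ⟨t, ht, rfl⟩ := isOpen_induced_iff.mp hu
    obtain ⟨_, ⟨s, rfl⟩, has, hst⟩ :=
      PrimeSpectrum.isTopologicalBasis_basic_opens.exists_subset_of_mem_open ha ht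
    exact ⟨s, has, fun b hb => hst hb⟩
  refine ⟨?_, ?_⟩
  · obtain ⟨a, ha, -⟩ := exists_mem_zeros_notMem (q.ne_top_iff_one.mp hq.ne_top)
    exact ⟨a, ha⟩
  · rintro u v hu hv ⟨a, haq, hau⟩ ⟨b, hbq, hbv⟩
    obtain ⟨s, hs, hsu⟩ := key u hu a hau
    obtain ⟨t, ht, htv⟩ := key v hv b hbv
    have hst : s * t ∉ q := fun h => (hq.mem_or_mem h).elim (fun h => hs (haq h))
      fun h => ht (hbq h)
    obtain ⟨c, hcq, hc⟩ := exists_mem_zeros_notMem hst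
    exact ⟨c, hcq, hsu c fun h => hc (Ideal.mul_mem_right _ _ h),
      htv c fun h => hc (Ideal.mul_mem_left _ _ h)⟩

end Points

/-! ### Components of the resonance variety -/

section Components

variable {k V : Type*} [Field k] [AddCommGroup V] [Module k V] {K : Submodule k (⋀[k]^2 V)}
  {U : Submodule k (Dual k V)}

theorem mem_resonance_iff {a : Dual k V} :
    a ∈ resonance K ↔ a = 0 ∨ ∃ b, wedge k _ a b ∈ perp K ∧ wedge k _ a b ≠ 0 := by
  rw [or_comm]
  rfl

theorem span_pair_subset_resonance {a b : Dual k V} (h : wedge k _ a b ∈ perp K)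
    (h0 : wedge k _ a b ≠ 0) : (Submodule.span k {a, b} : Set (Dual k V)) ⊆ resonance K := by
  intro c hc
  obtain ⟨r, s, rfl⟩ := Submodule.mem_span_pair.mp hc
  rw [mem_resonance_iff]
  by_cases hs : s = 0
  · by_cases hr : r = 0
    · simp [hr, hs]
    · right
      refine ⟨b, ?_⟩
      simp only [hs, zero_smul, add_zero, map_smul, LinearMap.smul_apply]
      exact ⟨Submodule.smul_mem _ _ h, smul_ne_zero hr h0⟩
  · right
    refine ⟨a, ?_⟩
    simp only [map_add, map_smul, LinearMap.add_apply, LinearMap.smul_apply, wedge_self,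
      smul_zero, zero_add]
    rw [wedge_swap]
    exact ⟨Submodule.smul_mem _ _ (neg_mem h), smul_ne_zero hs (neg_ne_zero.mpr h0)⟩

/-- Zorn's lemma: points in two opens that meet the union of a chain already lie in one member of
the chain. -/
theorem exists_isComponent {s : Set (Dual k V)} (hs : @IsIrreducible _ (zariski k V) s)
    (hs' : s ⊆ resonance K) : ∃ C, IsComponent K C ∧ s ⊆ C := by
  let _ := zariski k V
  obtain ⟨C, hsC, hC⟩ := zorn_subset_nonempty {s | IsIrreducible s ∧ s ⊆ resonance K} (by
    intro c hc hchain hne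
    refine ⟨⋃₀ c, ⟨⟨?_, ?_⟩, Set.sUnion_subset fun t ht => (hc ht).2⟩,
      fun t ht => Set.subset_sUnion_of_mem ht⟩
    · obtain ⟨t, ht⟩ := hne
      exact (hc ht).1.1.mono (Set.subset_sUnion_of_mem ht)
    · rintro u v hu hv ⟨x, ⟨p, hp, hxp⟩, hxu⟩ ⟨y, ⟨q, hq, hyq⟩, hyv⟩
      rcases hchain.total hp hq with h | h
      · obtain ⟨z, hz, hz'⟩ := (hc hq).1.2 u v hu hv ⟨x, h hxp, hxu⟩ ⟨y, hyq, hyv⟩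
        exact ⟨z, ⟨q, hq, hz⟩, hz'⟩
      · obtain ⟨z, hz, hz'⟩ := (hc hp).1.2 u v hu hv ⟨x, hxp, hxu⟩ ⟨y, h hyq, hyv⟩
        exact ⟨z, ⟨p, hp, hz⟩, hz'⟩) s ⟨hs, hs'⟩
  exact ⟨C, hC, hsC⟩

theorem isIsotropic_bot : IsIsotropic K (⊥ : Submodule k (Dual k V)) := by
  rw [isIsotropic_iff]
  rintro a ha b -
  rw [(Submodule.mem_bot k).mp ha, map_zero, LinearMap.zero_apply]
  exact zero_mem _

variable [FiniteDimensional k V]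

theorem zeros_subset_resonance {q : Ideal (SymmAlg k V)} (hq : resIdeal K ≤ q) :
    zeros q ⊆ resonance K := by
  intro a ha
  by_cases h : a = 0
  · exact Or.inr h
  · exact mem_resonance_of_resIdeal_le h (hq.trans ha)

theorem isSeparable_bot [CharZero k] : IsSeparable K (⊥ : Submodule k (Dual k V)) := by
  intro w _ hw
  refine mem_wedgeSq_of_pairingDual fun v x hx => pairingDual_eq_zero_of_mem_span hw ?_ hx
  simp

theorem isStronglyIsotropic_bot [CharZero k] : IsStronglyIsotropic K (⊥ : Submodule k (Dual k V)) :=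
  ⟨isSeparable_bot, isIsotropic_bot⟩

variable [IsAlgClosed k]

/-- The zeros of `q` form an irreducible subset of the resonance containing `U`. Maximality makes
them equal to `U`, and the Nullstellensatz returns to ideals. -/
theorem IsComponent.eq_of_le (hU : IsComponent K (U : Set (Dual k V))) {q : Ideal (SymmAlg k V)}
    [q.IsPrime] (hq : resIdeal K ≤ q) (hqU : q ≤ linearIdeal U) : q = linearIdeal U := by
  refine hqU.antisymm (le_of_zeros_subset ?_)
  have h1 : (U : Set (Dual k V)) ⊆ zeros q := by
    rw [← zeros_linearIdeal U]
    exact fun a ha => hqU.trans ha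
  rw [zeros_linearIdeal]
  exact hU.2 ⟨isIrreducible_zeros q, zeros_subset_resonance hq⟩ h1

theorem IsComponent.eq_of_le_submodule (hU : IsComponent K (U : Set (Dual k V)))
    {T : Submodule k (Dual k V)} (hUT : U ≤ T) (hT : (T : Set (Dual k V)) ⊆ resonance K) :
    T ≤ U :=
  hU.2 ⟨zeros_linearIdeal T ▸ isIrreducible_zeros (linearIdeal T), hT⟩ hUT

/-- A nonzero resonant `a` has a partner `b`, and the whole plane spanned by `a` and `b` is
resonant. A line is therefore never maximal. -/
theorem IsComponent.not_le_span_singleton (hU : IsComponent K (U : Set (Dual k V))) (h0 : U ≠ ⊥)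
    (u : Dual k V) : ¬ U ≤ k ∙ u := by
  intro hu
  obtain ⟨a, ha, ha0⟩ := Submodule.exists_mem_ne_zero_of_ne_bot h0
  obtain ⟨r, rfl⟩ := Submodule.mem_span_singleton.mp (hu ha)
  have hr : r ≠ 0 := fun h => ha0 (by rw [h, zero_smul])
  obtain ⟨b, hb, hb0⟩ := (mem_resonance_iff.mp (hU.1.2 ha)).resolve_left ha0
  have hUT : U ≤ Submodule.span k {r • u, b} := hu.trans <| by
    rw [Submodule.span_singleton_le_iff_mem]
    have : r⁻¹ • r • u ∈ Submodule.span k {r • u, b} :=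
      Submodule.smul_mem _ _ (Submodule.subset_span (by simp))
    rwa [smul_smul, inv_mul_cancel₀ hr, one_smul] at this
  have hbU : b ∈ U := hU.eq_of_le_submodule hUT (span_pair_subset_resonance hb hb0)
    (Submodule.subset_span (by simp))
  obtain ⟨s, rfl⟩ := Submodule.mem_span_singleton.mp (hu hbU)
  simp [wedge_self] at hb0

theorem IsComponent.resonance_eq (hU : IsComponent K ((⊥ : Submodule k (Dual k V)) : Set _)) :
    resonance K ⊆ {0} := by
  intro a ha
  rcases mem_resonance_iff.mp ha with h | ⟨b, hb, hb0⟩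
  · exact h
  · have := hU.eq_of_le_submodule bot_le (span_pair_subset_resonance hb hb0)
      (Submodule.subset_span (Set.mem_insert a _))
    exact this

end Components

/-! ## The projective resonance scheme -/

section ReducedImage

open CategoryTheory TopologicalSpace

/-- The scheme-theoretic image of a reduced scheme is reduced. -/
theorem isReduced_image {X Y : Scheme} (f : X ⟶ Y) [QuasiCompact f]
    [AlgebraicGeometry.IsReduced X] : AlgebraicGeometry.IsReduced f.image := by
  have : IsSchemeTheoreticallyDominant f.toImage := by
    rw [isSchemeTheoreticallyDominant_iff]
    -- Affine opens of `Y` pull back to an affine cover of the image, and on each of them sections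
    -- inject into those of `X`.
    refine Scheme.IdealSheafData.ext_of_iSup_eq_top
      (fun U : Y.affineOpens => ⟨f.imageι ⁻¹ᵁ U, U.2.preimage f.imageι⟩) ?_ fun U => ?_
    · refine top_le_iff.mp fun x _ => ?_
      obtain ⟨_, ⟨W, hW, rfl⟩, hxW, -⟩ :=
        Y.isBasis_affineOpens.exists_subset_of_mem_open (Set.mem_univ (f.imageι x)) isOpen_univ
      exact Opens.mem_iSup.mpr ⟨⟨W, hW⟩, hxW⟩
    · rw [Scheme.Hom.ker_apply, Scheme.IdealSheafData.ideal_bot]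
      exact (RingHom.injective_iff_ker_eq_bot _).mp (f.toImage_app_injective U)
  exact IsSchemeTheoreticallyDominant.isReduced f.toImage

end ReducedImage

/-! ### Points and stalks of the projective resonance scheme -/

section Stalks

variable {k V : Type*} [Field k] [AddCommGroup V] [Module k V] {U : Submodule k (Dual k V)}
  {K : Submodule k (⋀[k]^2 V)}

/-- A point of the projective resonance scheme, as a point of the projective spectrum. -/
def asPoint (x : projResonance K) : ProjectiveSpectrum (resGrading K) := x

/-- The homogeneous prime ideal of `Sym V` of a point of the projective resonance scheme. -/
def pointIdeal (x : projResonance K) : Ideal (SymmAlg k V) :=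
  (asPoint x).asHomogeneousIdeal.toIdeal.comap
    (Ideal.Quotient.mk (resIdeal K))

instance (x : projResonance K) : (pointIdeal x).IsPrime := by
  exact Ideal.IsPrime.comap _

theorem mk_mem_iff_mem_pointIdeal {x : projResonance K} {s : SymmAlg k V} :
    Ideal.Quotient.mk (resIdeal K) s ∈
      (asPoint x).asHomogeneousIdeal.toIdeal ↔ s ∈ pointIdeal x :=
  Iff.rfl

theorem resIdeal_le_pointIdeal (x : projResonance K) : resIdeal K ≤ pointIdeal x := by
  intro s hs
  rw [← mk_mem_iff_mem_pointIdeal, Ideal.Quotient.eq_zero_iff_mem.mpr hs]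
  exact zero_mem _

theorem mk_ι_mem_resGrading (v : V) :
    Ideal.Quotient.mk (resIdeal K) (symι k V v) ∈ resGrading K 1 :=
  ⟨_, ι_mem_symPow k V v, rfl⟩

theorem exists_ι_notMem_pointIdeal (x : projResonance K) : ∃ y, symι k V y ∉ pointIdeal x := by
  by_contra! H
  refine ProjectiveSpectrum.not_irrelevant_le (asPoint x) ?_
  rw [HomogeneousIdeal.irrelevant_le]
  rintro (_ | i) hi _ ⟨s, hs, rfl⟩
  · exact absurd hi (lt_irrefl 0)
  change s ∈ pointIdeal x
  replace hs : s ∈ LinearMap.range (symι k V) ^ i * LinearMap.range (symι k V) := hs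
  induction hs using Submodule.mul_induction_on' with
  | mem_mul_mem a _ b hb =>
    obtain ⟨y, rfl⟩ := hb
    exact Ideal.mul_mem_left _ _ (H y)
  | add a _ b _ ha hb => exact add_mem ha hb

theorem mem_linearLocus {x : projResonance K} :
    x ∈ linearLocus K U ↔ linearIdeal U ≤ pointIdeal x := by
  rw [linearLocus, linearIdeal_le_iff]
  refine (ProjectiveSpectrum.mem_zeroLocus _ (asPoint x) _).trans ?_
  rw [Set.image_subset_iff]
  refine forall_congr' fun v => ?_
  rw [Submodule.mem_dualCoannihilator]
  rfl

theorem mem_closure_singleton_iff {x y : projResonance K} :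
    y ∈ closure ({x} : Set (projResonance K)) ↔ pointIdeal x ≤ pointIdeal y := by
  refine (ProjectiveSpectrum.le_iff_mem_closure (𝒜 := resGrading K) x y).symm.trans ?_
  refine ⟨fun h s hs => h hs, fun h s hs => ?_⟩
  obtain ⟨s, rfl⟩ := Ideal.Quotient.mk_surjective s
  exact h hs

/-- Fractions in the stalks of the projective resonance scheme. -/
theorem mk_pow_eq_zero_iff (x : projResonance K)
    (c : HomogeneousLocalization.NumDenSameDeg (resGrading K)
      (asPoint x).asHomogeneousIdeal.toIdeal.primeCompl) (s : SymmAlg k V)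
    (hs : Ideal.Quotient.mk (resIdeal K) s = c.num) (n : ℕ) :
    HomogeneousLocalization.mk c ^ n = 0 ↔ ∃ g ∉ pointIdeal x, g * s ^ n ∈ resIdeal K := by
  rw [HomogeneousLocalization.ext_iff_val, HomogeneousLocalization.val_pow,
    HomogeneousLocalization.val_zero, HomogeneousLocalization.val_mk, Localization.mk_pow, ← hs,
    Localization.mk_eq_mk', IsLocalization.mk'_eq_zero_iff]
  constructor
  · rintro ⟨⟨g, hg⟩, h⟩
    obtain ⟨g, rfl⟩ := Ideal.Quotient.mk_surjective g
    refine ⟨g, hg, Ideal.Quotient.eq_zero_iff_mem.mp ?_⟩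
    rw [map_mul, map_pow]
    exact h
  · rintro ⟨g, hg, h⟩
    refine ⟨⟨Ideal.Quotient.mk _ g, hg⟩, ?_⟩
    rw [← map_pow, ← map_mul]
    exact Ideal.Quotient.eq_zero_iff_mem.mpr h

/-- The stalk of the projective resonance scheme at a point. -/
def stalkEquiv (x : projResonance K) : (projResonance K).presheaf.stalk x ≃+*
    HomogeneousLocalization.AtPrime (resGrading K) (asPoint x).asHomogeneousIdeal.toIdeal :=
  Proj.stalkIso' (resGrading K) x

/-- The numerator of a nilpotent fraction lies in the prime `linearIdeal U`, because `I` does and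
`g` is a unit at `x`. Multiplication by `f` sends that prime into `I`, so the fraction is zero. -/
theorem isReduced_stalk (x : projResonance K) (hK : resIdeal K ≤ linearIdeal U)
    (hx : linearIdeal U ≤ pointIdeal x)
    (h : ∃ f ∉ pointIdeal x, ∀ v ∈ U.dualCoannihilator, f * symι k V v ∈ resIdeal K) :
    _root_.IsReduced ((projResonance K).presheaf.stalk x) := by
  have : _root_.IsReduced (HomogeneousLocalization.AtPrime (resGrading K)
      (asPoint x).asHomogeneousIdeal.toIdeal) := by
    refine ⟨fun z hz => ?_⟩
    obtain ⟨n, hn⟩ := hz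
    obtain ⟨c, rfl⟩ := HomogeneousLocalization.mk_surjective z
    obtain ⟨s, hs⟩ := Ideal.Quotient.mk_surjective (c.num : SymmAlg k V ⧸ resIdeal K)
    obtain ⟨g, hg, hgs⟩ := (mk_pow_eq_zero_iff x c s hs n).mp hn
    obtain ⟨f, hf, hfU⟩ := h
    have hsU : s ∈ linearIdeal U := Ideal.IsPrime.mem_of_pow_mem inferInstance n
      ((Ideal.IsPrime.mem_or_mem inferInstance (hK hgs)).resolve_left fun h => hg (hx h))
    have hle : linearIdeal U ≤ Submodule.comap (LinearMap.mulLeft (SymmAlg k V) f) (resIdeal K) :=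
      linearIdeal_le_iff.mpr hfU
    rw [← pow_one (HomogeneousLocalization.mk c), mk_pow_eq_zero_iff x c s hs]
    exact ⟨f, hf, by rw [pow_one]; exact hle hsU⟩
  exact isReduced_of_injective _ (stalkEquiv x).injective

theorem exists_mul_mem_of_isReduced_stalk (x : projResonance K)
    (hx : pointIdeal x = linearIdeal U)
    (hmin : ∀ q : Ideal (SymmAlg k V), q.IsPrime → resIdeal K ≤ q → q ≤ linearIdeal U →
      q = linearIdeal U)
    (hred : _root_.IsReduced ((projResonance K).presheaf.stalk x))
    {v : V} (hv : v ∈ U.dualCoannihilator) :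
    ∃ f ∉ linearIdeal U, f * symι k V v ∈ resIdeal K := by
  have hred' : _root_.IsReduced (HomogeneousLocalization.AtPrime (resGrading K)
      (asPoint x).asHomogeneousIdeal.toIdeal) :=
    isReduced_of_injective _ (stalkEquiv x).symm.injective
  obtain ⟨y, hy⟩ := exists_ι_notMem_pointIdeal x
  -- Dividing by a linear form `y` that is invertible at `x` turns `v` into a degree-zero fraction,
  -- which lives in the stalk.
  let c : HomogeneousLocalization.NumDenSameDeg (resGrading K)
      (asPoint x).asHomogeneousIdeal.toIdeal.primeCompl :=
    ⟨1, ⟨_, mk_ι_mem_resGrading v⟩, ⟨_, mk_ι_mem_resGrading y⟩, hy⟩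
  have hnil : ∃ n, ∃ g ∉ linearIdeal U, g * symι k V v ^ n ∈ resIdeal K := by
    by_contra! H
    -- A prime over `I` avoiding `M` would lie inside `linearIdeal U` and omit `v`, against
    -- minimality. Hence `v` is nilpotent at the generic point.
    let M : Submonoid (SymmAlg k V) := (linearIdeal U).primeCompl ⊔ Submonoid.powers (symι k V v)
    have hM : Disjoint (resIdeal K : Set (SymmAlg k V)) M := by
      rw [Set.disjoint_right]
      intro m hm hmK
      obtain ⟨g, hg, _, ⟨n, rfl⟩, rfl⟩ := Submonoid.mem_sup.mp hm
      exact H n g hg hmK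
    obtain ⟨q, hq, hKq, hqM⟩ := Ideal.exists_le_prime_disjoint _ M hM
    have hqU : q ≤ linearIdeal U := by
      intro s hs
      by_contra hsU
      exact Set.disjoint_left.mp hqM hs ((le_sup_left : _ ≤ M) hsU)
    refine Set.disjoint_left.mp hqM ?_ ((le_sup_right : _ ≤ M) (Submonoid.mem_powers _))
    rw [hmin q hq hKq hqU]
    exact linearIdeal_le_iff.mp le_rfl v hv
  obtain ⟨n, hn⟩ := hnil
  rw [← hx] at hn ⊢
  have h0 := (mk_pow_eq_zero_iff x c _ rfl n).mpr hn
  have h1 : HomogeneousLocalization.mk c ^ 1 = 0 := by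
    rw [pow_one]
    exact IsReduced.eq_zero _ ⟨n, h0⟩
  simpa using (mk_pow_eq_zero_iff x c _ rfl 1).mp h1

end Stalks

/-! ### Generic points of linear components -/

section GenericPoint

variable {k V : Type*} [Field k] [AddCommGroup V] [Module k V] {U : Submodule k (Dual k V)}
  {K : Submodule k (⋀[k]^2 V)}

theorem linearIdeal_eq_span : linearIdeal U =
    Ideal.span (symι k V '' (U.dualCoannihilator : Set V)) := by
  refine le_antisymm (linearIdeal_le_iff.mpr fun x hx => Ideal.subset_span ⟨x, hx, rfl⟩) ?_
  rw [Ideal.span_le]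
  rintro _ ⟨x, hx, rfl⟩
  exact linearIdeal_le_iff.mp le_rfl x hx

/-- The generic point of a linear subspace that is contained in the resonance scheme. -/
theorem exists_pointIdeal_eq (hK : resIdeal K ≤ linearIdeal U) (h0 : U ≠ ⊥) :
    ∃ x : projResonance K, pointIdeal x = linearIdeal U := by
  set mk := Ideal.Quotient.mk (resIdeal K)
  have hker : RingHom.ker mk ≤ linearIdeal U := by rwa [Ideal.mk_ker]
  have hcomap : ((linearIdeal U).map mk).comap mk = linearIdeal U := by
    rw [Ideal.comap_map_of_surjective _ Ideal.Quotient.mk_surjective, sup_eq_left]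
    exact hker
  have hhom : ((linearIdeal U).map mk).IsHomogeneous (resGrading K) := by
    rw [linearIdeal_eq_span, Ideal.map_span]
    refine Ideal.homogeneous_span _ _ ?_
    rintro _ ⟨_, ⟨v, _, rfl⟩, rfl⟩
    exact ⟨1, mk_ι_mem_resGrading v⟩
  have hprime : ((linearIdeal U).map mk).IsPrime :=
    Ideal.map_isPrime_of_surjective Ideal.Quotient.mk_surjective hker
  obtain ⟨a, ha, ha0⟩ := Submodule.exists_mem_ne_zero_of_ne_bot h0
  obtain ⟨y, hy⟩ : ∃ y, a y ≠ 0 := by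
    by_contra! H
    exact ha0 (LinearMap.ext H)
  have hyU : symι k V y ∉ linearIdeal U := by
    have h1 : linearIdeal U ≤ evalIdeal a := linearIdeal_le_iff.mpr fun x hx =>
      ι_mem_evalIdeal.mpr ((Submodule.mem_dualCoannihilator _).mp hx a ha)
    exact fun h => hy (ι_mem_evalIdeal.mp (h1 h))
  let x : ProjectiveSpectrum (resGrading K) := ⟨⟨_, hhom⟩, hprime, fun h => hyU <| by
    rw [← hcomap]
    exact h (HomogeneousIdeal.mem_irrelevant_of_mem _ one_pos (mk_ι_mem_resGrading y))⟩
  exact ⟨x, hcomap⟩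

theorem linearLocus_eq_closure {x : projResonance K} (hx : pointIdeal x = linearIdeal U) :
    linearLocus K U = closure {x} := by
  ext y
  rw [mem_linearLocus, mem_closure_singleton_iff, hx]

/-- By sobriety, an irreducible set containing `P(U)` has a closure with a generic point, whose
prime lies between `I` and `linearIdeal U`. -/
theorem linearLocus_mem_irreducibleComponents {x : projResonance K}
    (hx : pointIdeal x = linearIdeal U)
    (hmin : ∀ q : Ideal (SymmAlg k V), q.IsPrime → resIdeal K ≤ q → q ≤ linearIdeal U →
      q = linearIdeal U) :
    linearLocus K U ∈ irreducibleComponents (projResonance K) := by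
  rw [linearLocus_eq_closure hx]
  refine ⟨isIrreducible_singleton.closure, fun T hT hxT => ?_⟩
  obtain ⟨t, ht⟩ := QuasiSober.sober hT.closure isClosed_closure
  have hxt : x ∈ closure {t} := by
    rw [ht.def]
    exact subset_closure (hxT (subset_closure rfl))
  rw [mem_closure_singleton_iff] at hxt
  have htU := hmin _ inferInstance (resIdeal_le_pointIdeal t) (hxt.trans hx.le)
  intro z hz
  have hzt : z ∈ closure {t} := by
    rw [ht.def]
    exact subset_closure hz
  rw [mem_closure_singleton_iff] at hzt ⊢
  rwa [hx, ← htU]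

end GenericPoint

/-! ## Components of the projective resonance scheme -/

theorem isGenericallyReduced_of_isReduced {X : Scheme}
    [AlgebraicGeometry.IsReduced X] : IsGenericallyReduced X :=
  ⟨⊤, by simp, inferInstance⟩

section ProjComponents

open CategoryTheory TopologicalSpace

variable {k V : Type*} [Field k] [AddCommGroup V] [Module k V]
  [FiniteDimensional k V] {K : Submodule k (⋀[k]^2 V)} {U : Submodule k (Dual k V)}

theorem mem_linearLocus_of_mem_irreducibleComponentOpen {x : projResonance K}
    (hx : x ∈ (projResonance K).irreducibleComponentOpen (linearLocus K U)) :
    x ∈ linearLocus K U := by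
  by_contra hxU
  exact hx ⟨irreducibleComponent x, ⟨irreducibleComponent_mem_irreducibleComponents x,
    fun h => hxU (h ▸ mem_irreducibleComponent)⟩, mem_irreducibleComponent⟩

/-- The component of the resonance scheme has the same stalk as the scheme at its generic point. -/
theorem isReduced_stalk_of_isGenericallyReduced {x : projResonance K}
    (hx : linearLocus K U = closure {x})
    (hU : linearLocus K U ∈ irreducibleComponents (projResonance K))
    (h : IsGenericallyReduced (projComponent K U)) :
    _root_.IsReduced ((projResonance K).presheaf.stalk x) := by
  set O := (projResonance K).irreducibleComponentOpen (linearLocus K U)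
  -- A component through the generic point contains all of `P(U)`, hence equals it.
  have hxO : x ∈ O := by
    rintro ⟨Z, ⟨hZ, hZU⟩, hxZ⟩
    refine hZU ?_
    have hle : linearLocus K U ⊆ Z := by
      rw [hx]
      exact closure_minimal (Set.singleton_subset_iff.mpr hxZ)
        (isClosed_of_mem_irreducibleComponents Z hZ)
    exact (hU.2 hZ.1 hle).antisymm hle
  obtain ⟨O', hdense, hred⟩ := h
  let g : O.toScheme ⟶ projComponent K U := O.ι.toImage
  have hg : IsOpenImmersion g := inferInstanceAs (IsOpenImmersion O.ι.toImage)
  obtain ⟨_, ⟨o, rfl⟩, ho⟩ := hdense.inter_open_nonempty (Set.range g) g.isOpenEmbedding.isOpen_range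
    ⟨_, ⟨x, hxO⟩, rfl⟩
  let x' : O.toScheme := ⟨x, hxO⟩
  -- Open sets are stable under generization, and `x'` specializes to every point of `O`.
  have hxo : g x' ∈ O' := by
    have h1 : x' ⤳ o := by
      rw [← O.ι.isOpenEmbedding.isInducing.specializes_iff, specializes_iff_mem_closure]
      exact hx ▸ mem_linearLocus_of_mem_irreducibleComponentOpen o.2
    exact (h1.map g.continuous).mem_open O'.isOpen ho
  have h0 : _root_.IsReduced (O'.toScheme.presheaf.stalk ⟨_, hxo⟩) :=
    isReduced_stalk_of_isReduced (X := O'.toScheme) ⟨_, hxo⟩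
  have h1 : _root_.IsReduced ((projComponent K U).presheaf.stalk (g x')) :=
    isReduced_of_injective _ (O'.stalkIso ⟨_, hxo⟩).symm.commRingCatIsoToRingEquiv.injective
  have h3 : IsIso (g.stalkMap x') := inferInstance
  have h2 : _root_.IsReduced (O.toScheme.presheaf.stalk x') :=
    isReduced_of_injective _ (asIso (g.stalkMap x')).symm.commRingCatIsoToRingEquiv.injective
  exact isReduced_of_injective _ (O.stalkIso x').symm.commRingCatIsoToRingEquiv.injective

/-- The open subscheme has the stalks of the ambient scheme at points of `P(U)`. Reducedness then
passes to its scheme-theoretic image. -/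
theorem isReduced_projComponent (h : ∀ x ∈ linearLocus K U,
    _root_.IsReduced ((projResonance K).presheaf.stalk x)) :
    AlgebraicGeometry.IsReduced (projComponent K U) := by
  set O := (projResonance K).irreducibleComponentOpen (linearLocus K U)
  have : AlgebraicGeometry.IsReduced O.toScheme := by
    have : ∀ y : O.toScheme, _root_.IsReduced (O.toScheme.presheaf.stalk y) := by
      intro y
      have := h y.1 (mem_linearLocus_of_mem_irreducibleComponentOpen y.2)
      exact isReduced_of_injective _ (O.stalkIso y).commRingCatIsoToRingEquiv.injective
    exact isReduced_of_isReduced_stalk _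
  exact isReduced_image O.ι

variable [IsAlgClosed k]

/-- Here the resonance is `{0}`. A point of `Proj` omits some linear form, so the zeros of its prime
include a nonzero vector. -/
theorem IsComponent.isEmpty_projResonance
    (hU : IsComponent K ((⊥ : Submodule k (Dual k V)) : Set _)) : IsEmpty (projResonance K) := by
  refine ⟨fun x => ?_⟩
  obtain ⟨y, hy⟩ := exists_ι_notMem_pointIdeal x
  obtain ⟨a, ha, hay⟩ := exists_mem_zeros_notMem hy
  have h0 : a = 0 := hU.resonance_eq (zeros_subset_resonance (resIdeal_le_pointIdeal x) ha)
  exact hay (ι_mem_evalIdeal.mpr (by simp [h0]))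

variable [CharZero k]

theorem IsStronglyIsotropic.isReduced_stalk (hU : IsComponent K (U : Set (Dual k V)))
    (h : IsStronglyIsotropic K U) {x : projResonance K} (hx : x ∈ linearLocus K U) :
    _root_.IsReduced ((projResonance K).presheaf.stalk x) := by
  by_cases h0 : U = ⊥
  · subst h0
    exact hU.isEmpty_projResonance.elim x
  rw [mem_linearLocus] at hx
  obtain ⟨y, hy⟩ := exists_ι_notMem_pointIdeal x
  exact Resonance.isReduced_stalk x (resIdeal_le_linearIdeal h.2 (hU.not_le_span_singleton h0)) hx
    (h.1.exists_mul_mem _ hx hy)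

theorem IsComponent.exists_genericPoint (hU : IsComponent K (U : Set (Dual k V)))
    (hI : IsIsotropic K U) (h0 : U ≠ ⊥) : ∃ x : projResonance K, linearLocus K U = closure {x} ∧
      linearLocus K U ∈ irreducibleComponents (projResonance K) ∧
      (_root_.IsReduced ((projResonance K).presheaf.stalk x) → IsStronglyIsotropic K U) := by
  have h2 := hU.not_le_span_singleton h0
  have hmin : ∀ q : Ideal (SymmAlg k V), q.IsPrime → resIdeal K ≤ q → q ≤ linearIdeal U →
      q = linearIdeal U := fun q _ h h' => hU.eq_of_le h h'
  obtain ⟨x, hx⟩ := exists_pointIdeal_eq (resIdeal_le_linearIdeal hI h2) h0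
  exact ⟨x, linearLocus_eq_closure hx, linearLocus_mem_irreducibleComponents hx hmin, fun h =>
    ⟨isSeparable_of_exists_mul_mem hI h2 fun v hv =>
      exists_mul_mem_of_isReduced_stalk x hx hmin h hv, hI⟩⟩

end ProjComponents

end Resonance

end

theorem mainTheorem4 {k V : Type*} [Field k] [IsAlgClosed k] [CharZero k]
    [AddCommGroup V] [Module k V] [FiniteDimensional k V] (K : Submodule k (⋀[k]^2 V)) :
    (∀ U : Submodule k (Dual k V),
      Resonance.IsComponent K (U : Set (Dual k V)) → Resonance.IsIsotropic K U →
        (U ≠ ⊥ → Resonance.linearLocus K U ∈ irreducibleComponents (Resonance.projResonance K)) ∧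
        List.TFAE [
          AlgebraicGeometry.IsReduced (Resonance.projComponent K U),
          Resonance.IsGenericallyReduced (Resonance.projComponent K U),
          Resonance.IsStronglyIsotropic K U]) ∧
    (Resonance.IsotropicResonance K →
      (Resonance.StronglyIsotropicResonance K ↔ AlgebraicGeometry.IsReduced (Resonance.projResonance K))) := by
  open Resonance in
  refine ⟨fun U hU hI => ⟨fun h0 => ?_, ?_⟩, fun hK => ⟨fun hS => ?_, fun hred C hC => ?_⟩⟩
  · obtain ⟨x, -, h, -⟩ := hU.exists_genericPoint hI h0
    exact h
  · tfae_have 1 → 2 := fun _ => isGenericallyReduced_of_isReduced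
    tfae_have 2 → 3 := by
      intro h
      by_cases h0 : U = ⊥
      · exact h0 ▸ isStronglyIsotropic_bot
      · obtain ⟨x, hx, hxU, hS⟩ := hU.exists_genericPoint hI h0
        exact hS (isReduced_stalk_of_isGenericallyReduced hx hxU h)
    tfae_have 3 → 1 := fun h => isReduced_projComponent fun x hx => h.isReduced_stalk hU hx
    tfae_finish
  · have (x : projResonance K) : _root_.IsReduced ((projResonance K).presheaf.stalk x) := by
      -- The component chosen contains the zeros of the prime of `x`, so by the Nullstellensatz `x`
      -- lies on the corresponding linear subspace.
      obtain ⟨C, hC, hxC⟩ := exists_isComponent (isIrreducible_zeros (pointIdeal x))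
        (zeros_subset_resonance (resIdeal_le_pointIdeal x))
      obtain ⟨U, rfl, hU⟩ := hS C hC
      refine hU.isReduced_stalk hC (mem_linearLocus.mpr (le_of_zeros_subset ?_))
      rwa [zeros_linearIdeal]
    exact isReduced_of_isReduced_stalk _
  · obtain ⟨U, rfl, hI⟩ := hK C hC
    refine ⟨U, rfl, ?_⟩
    by_cases h0 : U = ⊥
    · exact h0 ▸ isStronglyIsotropic_bot
    · obtain ⟨x, -, -, hS⟩ := hC.exists_genericPoint hI h0
      exact hS inferInstance
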